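/- **Setting.** Let $b,d,\xi>0$, $\Omega=\{(x,y,z):|x|,|y|<b,\ -\xi<z<d\}$, $\Gamma=\{|x|,|y|<b,\ z=-\xi\}$, $s>\xi$, $0<\underline k<\overline k$, $\lambda,\nu,\rho>0$. Let $\varphi_\mu(z)=\exp[2\mu(z+s)^{-\nu}]$ and $t_\nu=(s-\xi)^{-\nu}-(s+d)^{-\nu}$. Spaces of complex valued functions are regarded as real Hilbert spaces. Let $H_m=L^2([\underline k,\overline k];H^m(\Omega))$ with $\|f\|_{H_m}^2=\int_{\underline k}^{\overline k}\|f(\cdot,k)\|_{H^m(\Omega)}^2dk$, and $$H_0^3(\Omega)=\{f\in H^3(\Omega): f|_{\partial\Omega}=0,\ f_z|_\Gamma=0\},\qquad H_3^0=\{f\in H_3: f(\cdot,k)\in H^3_0(\Omega)\text{ for a.e. }k\in[\underline k,\overline k]\},$$ $B(R')=\{f\in H_3^0:\|f\|_{H_3}<R'\}$. *Tail function.* Let $\delta\in(0,1)$ and let $Q,Q_*,V_*\in H^3(\Omega)$ with $\|Q-Q_*\|_{H^3(\Omega)}<\delta$, where $Q=\psi_0,\ Q_z=\psi_1$ on $\Gamma$,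 $Q=0$ on $\partial\Omega\setminus\Gamma$; where $Q_*=\psi_{0*},\ \partial_zQ_*=\psi_{1*}$ on $\Gamma$, $Q_*=0$ on $\partial\Omega\setminus\Gamma$; and where $V_*$ satisfies the same boundary conditions as $Q_*$ and $\Delta V_*=0$ in $\Omega$. Put $\alpha=\delta$, $\mu=\ln(\delta^{-1/(2t_\nu)})$ and $$I_{\mu,\alpha}(U)=e^{-2\mu(s+d)^{-\nu}}\int_\Omega|\Delta U|^2\varphi_\mu(z)\,d\mathbf x+\alpha\|U\|_{H^3(\Omega)}^2 .$$ Let $V=W+Q$, where $W$ minimizes $W'\mapsto I_{\mu,\alpha}(W'+Q)$ over $H^3_0(\Omega)$. *Functional.* Let $F,F_*\in H_4$ with $\|F-F_*\|_{H_4}<\delta$ and, for a.e. $k$, $F=\phi_0,\ F_z=\phi_1$ on $\Gamma$, $F=0$ on $\partial\Omega\setminus\Gamma$, and likewise for $F_*$ with data $\phi_{0*},\phi_{1*}$. Let $$L(q)=\Delta q+2k\Big(\nabla V-\int_k^{\overline k}\nabla q\,d\kappa\Big)\cdot\Big(k\nabla q+\nabla V-\int_k^{\overline k}\nabla q\,d\kappa\Big)+2i\Big(kq_z+V_z-\int_k^{\overline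 k}q_z\,d\kappa\Big),$$ $$J_{\lambda,\rho}(p)=e^{-2\lambda(s+d)^{-\nu}}\int_{\underline k}^{\overline k}\int_\Omega|L(p+F)(\mathbf x,\kappa)|^2\varphi_\lambda^2(z)\,d\mathbf x\,d\kappa+\rho\|p\|_{H_3}^2 .$$ **Theorem 4.4.** For every $R'>0$ and all numbers $N_F,N_V$ there is a constant $M>0$, depending only on $\Omega,s,R',N_F,N_V,\lambda,\nu,\rho,\underline k,\overline k$, such that for all $\delta$ and all $Q,Q_*,V_*,V,F,F_*$ as above with $\|F_*\|_{H_4}\le N_F$ and $\|V_*\|_{H^3(\Omega)}\le N_V$ the following holds. The integrals defining $J_{\lambda,\rho}(p)$ converge for all $p\in H_3^0$. The functional $J_{\lambda,\rho}$, given on $H_3$ by the above formula, has at every $p\in H_3^0$ a Fréchet derivative $J'_{\lambda,\rho}(p)$, identified with an element of $H_3$ by the Riesz theorem, and $$\|J'_{\lambda,\rho}(p_1)-J'_{\lambda,\rho}(p_2)\|_{H_3}\le M\|p_1-p_2\|_{H_3}\qquad\forall p_1,p_2\in B(R').$$ The restriction of $J_{\lambda,\rho}$ to $H_3^0$ is also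 Fréchet differentiable on $H_3^0$, and its derivative satisfies the same inequality on $B(R')$ in the norm of the dual of $H_3^0$. -/

import Mathlib

open MeasureTheory Set Topology
open scoped ContDiff Distributions

namespace Convexification

noncomputable section

/-- The physical space, with coordinates `x = x 0`, `y = x 1`, `z = x 2`. -/
abbrev Space : Type := EuclideanSpace ℝ (Fin 3)

/-! ### Weak derivatives and the Sobolev spaces `H^m(Ω)` of complex valued functions -/

/-- The classical partial derivative in the direction of the `i`-th coordinate. -/
def partialDeriv (i : Fin 3) (φ : Space → ℝ) : Space → ℝ :=
  fun x => fderiv ℝ φ x (EuclideanSpace.single i 1)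

/-- The classical partial derivative `∂^α` of a real function, for a multi-index `α`. -/
def multiDeriv (α : Fin 3 → ℕ) (φ : Space → ℝ) : Space → ℝ :=
  (partialDeriv 0)^[α 0] ((partialDeriv 1)^[α 1] ((partialDeriv 2)^[α 2] φ))

/-- The finite set of multi-indices of order at most `m`. -/
def multiIdx (m : ℕ) : Finset (Fin 3 → ℕ) :=
  (Fintype.piFinset fun _ : Fin 3 => Finset.range (m + 1)).filter fun α => ∑ i, α i ≤ m

theorem mem_multiIdx {m : ℕ} {α : Fin 3 → ℕ} : α ∈ multiIdx m ↔ ∑ i, α i ≤ m := by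
  simp only [multiIdx, Finset.mem_filter, Fintype.mem_piFinset, Finset.mem_range,
    and_iff_right_iff_imp]
  intro h i
  have := Finset.single_le_sum (f := α) (fun j _ => Nat.zero_le _) (Finset.mem_univ i)
  omega

/-- `g` is the weak derivative `∂^α f` on the open set `Ω`. -/
def IsWeakDeriv (Ω : TopologicalSpace.Opens Space) (α : Fin 3 → ℕ) (f g : Space → ℂ) : Prop :=
  ∀ φ : 𝓓(Ω, ℝ), ∫ x in (Ω : Set Space), f x * (multiDeriv α φ x : ℂ) =
    (-1) ^ (∑ i, α i) * ∫ x in (Ω : Set Space), g x * (φ x : ℂ)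

/-- `L²(Ω; ℂ)`. -/
abbrev L2 (Ω : TopologicalSpace.Opens Space) : Type :=
  Lp ℂ 2 (volume.restrict (Ω : Set Space))

/-- Families `(u_α)_{|α| ≤ m}` in `L²(Ω; ℂ)`, with the norm `(∑ ‖u_α‖²)^{1/2}`. -/
abbrev Jet (Ω : TopologicalSpace.Opens Space) (m : ℕ) : Type :=
  PiLp 2 fun _ : multiIdx m => L2 Ω

/-- The multi-index zero. -/
def zeroIdx (m : ℕ) : multiIdx m := ⟨0, mem_multiIdx.2 (by simp)⟩

theorem partialDeriv_contDiff (i : Fin 3) {φ : Space → ℝ} (h : ContDiff ℝ ∞ φ) :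
    ContDiff ℝ ∞ (partialDeriv i φ) :=
  (h.fderiv_right (m := ∞) (by norm_cast)).clm_apply contDiff_const

theorem multiDeriv_good (α : Fin 3 → ℕ) {φ : Space → ℝ} (h : ContDiff ℝ ∞ φ)
    (hc : HasCompactSupport φ) :
    ContDiff ℝ ∞ (multiDeriv α φ) ∧ HasCompactSupport (multiDeriv α φ) := by
  have key : ∀ (i : Fin 3) (n : ℕ) (ψ : Space → ℝ), ContDiff ℝ ∞ ψ ∧ HasCompactSupport ψ →
      ContDiff ℝ ∞ ((partialDeriv i)^[n] ψ) ∧ HasCompactSupport ((partialDeriv i)^[n] ψ) := by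
    intro i n
    induction n with
    | zero => intro ψ h; exact h
    | succ n ih =>
      intro ψ h
      rw [Function.iterate_succ_apply]
      exact ih _ ⟨partialDeriv_contDiff i h.1, h.2.fderiv_apply ℝ _⟩
  exact key _ _ _ (key _ _ _ (key _ _ _ ⟨h, hc⟩))

theorem memLp_of_smooth (Ω : TopologicalSpace.Opens Space) {ψ : Space → ℝ}
    (h : ContDiff ℝ ∞ ψ) (hc : HasCompactSupport ψ) :
    MemLp (fun x => (ψ x : ℂ)) 2 (volume.restrict (Ω : Set Space)) := by
  have h1 : Continuous fun x => (ψ x : ℂ) := Complex.continuous_ofReal.comp h.continuous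
  have h2 : HasCompactSupport fun x => (ψ x : ℂ) := hc.comp_left Complex.ofReal_zero
  exact (h1.memLp_of_hasCompactSupport h2).restrict _

theorem integral_mul_eq_inner (Ω : TopologicalSpace.Opens Space) {ψ : Space → ℝ}
    (h : ContDiff ℝ ∞ ψ) (hc : HasCompactSupport ψ) (f : L2 Ω) :
    ∫ x in (Ω : Set Space), f x * (ψ x : ℂ) =
      inner ℂ ((memLp_of_smooth Ω h hc).toLp _ : L2 Ω) f := by
  rw [MeasureTheory.L2.inner_def]
  refine integral_congr_ae ?_
  filter_upwards [(memLp_of_smooth Ω h hc).coeFn_toLp] with x hx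
  rw [hx]
  simp

theorem isWeakDeriv_iff (Ω : TopologicalSpace.Opens Space) (α : Fin 3 → ℕ) (f g : L2 Ω) :
    IsWeakDeriv Ω α f g ↔ ∀ φ : 𝓓(Ω, ℝ),
      inner ℂ ((memLp_of_smooth Ω (multiDeriv_good α φ.contDiff φ.hasCompactSupport).1
        (multiDeriv_good α φ.contDiff φ.hasCompactSupport).2).toLp _ : L2 Ω) f =
      (-1) ^ (∑ i, α i) *
        inner ℂ ((memLp_of_smooth Ω φ.contDiff φ.hasCompactSupport).toLp _ : L2 Ω) g := by
  refine forall_congr' fun φ => ?_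
  rw [← integral_mul_eq_inner Ω (multiDeriv_good α φ.contDiff φ.hasCompactSupport).1
      (multiDeriv_good α φ.contDiff φ.hasCompactSupport).2,
    ← integral_mul_eq_inner Ω φ.contDiff φ.hasCompactSupport]

/-- The Sobolev space `H^m(Ω) = W^{m,2}(Ω; ℂ)`: a function `u ∈ L²(Ω)` is stored together with all
its weak derivatives of order at most `m`, which are in `L²(Ω)`. It is a real Hilbert space
(complex valued functions are pairs of real ones), with the norm
`‖u‖² = ∑_{|α| ≤ m} ‖∂^α u‖²_{L²(Ω)}`. -/
def sobolev (Ω : TopologicalSpace.Opens Space) (m : ℕ) : Submodule ℝ (Jet Ω m) where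
  carrier := {u | ∀ α : multiIdx m, IsWeakDeriv Ω α (u (zeroIdx m)) (u α)}
  zero_mem' := by
    intro α
    rw [isWeakDeriv_iff]
    intro φ
    simp
  add_mem' := by
    intro u v hu hv α
    have hu := (isWeakDeriv_iff _ _ _ _).1 (hu α)
    have hv := (isWeakDeriv_iff _ _ _ _).1 (hv α)
    rw [isWeakDeriv_iff]
    intro φ
    simp only [PiLp.add_apply, inner_add_right, hu φ, hv φ, mul_add]
  smul_mem' := by
    intro c u hu α
    have hu := (isWeakDeriv_iff _ _ _ _).1 (hu α)
    rw [isWeakDeriv_iff]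
    intro φ
    simp only [PiLp.smul_apply]
    rw [← algebraMap_smul ℂ c (u (zeroIdx m)), ← algebraMap_smul ℂ c (u α),
      inner_smul_right, inner_smul_right, hu φ]
    ring

/-- The Sobolev space `H^m(Ω)` as a type, with the Hilbert space structure above. -/
def Sob (Ω : TopologicalSpace.Opens Space) (m : ℕ) : Type := ↥(sobolev Ω m)

instance (Ω : TopologicalSpace.Opens Space) (m : ℕ) : NormedAddCommGroup (Sob Ω m) :=
  inferInstanceAs (NormedAddCommGroup ↥(sobolev Ω m))

instance (Ω : TopologicalSpace.Opens Space) (m : ℕ) : InnerProductSpace ℝ (Sob Ω m) :=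
  inferInstanceAs (InnerProductSpace ℝ ↥(sobolev Ω m))

theorem isClosed_sobolev (Ω : TopologicalSpace.Opens Space) (m : ℕ) :
    IsClosed (sobolev Ω m : Set (Jet Ω m)) := by
  have : (sobolev Ω m : Set (Jet Ω m)) =
      ⋂ α : multiIdx m, {u | IsWeakDeriv Ω α (u (zeroIdx m)) (u α)} := by
    ext u
    simp only [mem_iInter, mem_ofPred_eq]
    rfl
  rw [this]
  refine isClosed_iInter fun α => ?_
  simp only [isWeakDeriv_iff, ofPred_forall]
  refine isClosed_iInter fun φ => isClosed_eq ?_ ?_ <;> fun_prop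

instance (Ω : TopologicalSpace.Opens Space) (m : ℕ) : CompleteSpace ↥(sobolev Ω m) :=
  (isClosed_sobolev Ω m).completeSpace_coe

instance (Ω : TopologicalSpace.Opens Space) (m : ℕ) : CompleteSpace (Sob Ω m) :=
  inferInstanceAs (CompleteSpace ↥(sobolev Ω m))

/-- The weak derivative `∂^α u ∈ L²(Ω)` of `u ∈ H^m(Ω)`; it is used for `|α| ≤ m` only. -/
def wderiv {Ω : TopologicalSpace.Opens Space} {m : ℕ} (α : Fin 3 → ℕ) (u : Sob Ω m) : L2 Ω :=
  if h : α ∈ multiIdx m then u.1 ⟨α, h⟩ else 0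

/-- The `i`-th component of the gradient. -/
def grad {Ω : TopologicalSpace.Opens Space} {m : ℕ} (u : Sob Ω m) (i : Fin 3) : L2 Ω :=
  wderiv (Pi.single i 1) u

/-- The Laplacian, as a function on `Ω` defined up to null sets. -/
def lap {Ω : TopologicalSpace.Opens Space} {m : ℕ} (u : Sob Ω m) : Space → ℂ :=
  fun x => ∑ i : Fin 3, wderiv (Pi.single i 2) u x

theorem multiIdx_mono {m n : ℕ} (h : m ≤ n) : multiIdx m ⊆ multiIdx n := fun _ hα =>
  mem_multiIdx.2 ((mem_multiIdx.1 hα).trans h)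

/-- The inclusion `H^n(Ω) ⊆ H^m(Ω)` for `m ≤ n`. -/
def incl (Ω : TopologicalSpace.Opens Space) {m n : ℕ} (h : m ≤ n) : Sob Ω n →L[ℝ] Sob Ω m :=
  LinearMap.mkContinuous
    { toFun := fun u => ⟨WithLp.toLp 2 fun α : multiIdx m =>
          u.1 ⟨α.1, multiIdx_mono h α.2⟩, fun α => u.2 ⟨α.1, multiIdx_mono h α.2⟩⟩
      map_add' := fun _ _ => rfl
      map_smul' := fun _ _ => rfl } 1 (by
    intro u
    rw [one_mul]
    refine le_of_sq_le_sq ?_ (norm_nonneg _)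
    change ‖(WithLp.toLp 2 fun α : multiIdx m =>
          u.1 ⟨α.1, multiIdx_mono h α.2⟩ : Jet Ω m)‖ ^ 2 ≤ ‖u.1‖ ^ 2
    rw [PiLp.norm_sq_eq_of_L2, PiLp.norm_sq_eq_of_L2]
    let e : multiIdx m ↪ multiIdx n := ⟨fun α => ⟨α.1, multiIdx_mono h α.2⟩, fun a b hab =>
      Subtype.ext (congrArg (fun c : multiIdx n => c.1) hab)⟩
    have := Finset.sum_le_univ_sum_of_nonneg (s := Finset.univ.map e)
      (f := fun α : multiIdx n => ‖u.1 α‖ ^ 2) (fun _ => by positivity)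
    rw [Finset.sum_map] at this
    exact this)

/-! ### The domain, boundary values -/

/-- The box `Ω = {|x| < b, |y| < b, -ξ < z < d}`. -/
def box (b d ξ : ℝ) : TopologicalSpace.Opens Space where
  carrier := {x | |x 0| < b ∧ |x 1| < b ∧ -ξ < x 2 ∧ x 2 < d}
  is_open' := by
    have h : ∀ i : Fin 3, Continuous fun x : Space => x i := fun i => by fun_prop
    exact (isOpen_lt (h 0).abs continuous_const).inter
      ((isOpen_lt (h 1).abs continuous_const).inter
        ((isOpen_lt continuous_const (h 2)).inter (isOpen_lt (h 2) continuous_const)))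

/-- The backscattering part `Γ = {|x| < b, |y| < b, z = -ξ}` of the boundary. -/
def backFace (b ξ : ℝ) : Set Space := {x | |x 0| < b ∧ |x 1| < b ∧ x 2 = -ξ}

/-- `f = ψ` on the part `S` of the boundary of `Ω`, where `f ∈ L²(Ω)` has a representative that is
continuous on the closure of `Ω` (which is then unique). This is used for `u ∈ H^m(Ω)` and its
first order derivatives with `m ≥ 3` only; these have such representatives. -/
def EqOnBdry {Ω : TopologicalSpace.Opens Space} (f : L2 Ω) (S : Set Space) (ψ : Space → ℂ) :
    Prop :=
  ∃ g : Space → ℂ, ContinuousOn g (closure (Ω : Set Space)) ∧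
    f =ᵐ[volume.restrict (Ω : Set Space)] g ∧ EqOn g ψ S

theorem EqOnBdry.zero {Ω : TopologicalSpace.Opens Space} (S : Set Space) :
    EqOnBdry (0 : L2 Ω) S 0 :=
  ⟨0, continuousOn_const, Lp.coeFn_zero _ _ _, fun _ _ => rfl⟩

theorem EqOnBdry.add {Ω : TopologicalSpace.Opens Space} {f g : L2 Ω} {S : Set Space}
    (hf : EqOnBdry f S 0) (hg : EqOnBdry g S 0) : EqOnBdry (f + g) S 0 := by
  obtain ⟨f', hf1, hf2, hf3⟩ := hf
  obtain ⟨g', hg1, hg2, hg3⟩ := hg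
  refine ⟨f' + g', hf1.add hg1, (Lp.coeFn_add f g).trans (hf2.add hg2), fun x hx => ?_⟩
  simp [hf3 hx, hg3 hx]

theorem EqOnBdry.smul {Ω : TopologicalSpace.Opens Space} {f : L2 Ω} {S : Set Space} (c : ℝ)
    (hf : EqOnBdry f S 0) : EqOnBdry (c • f) S 0 := by
  obtain ⟨f', hf1, hf2, hf3⟩ := hf
  refine ⟨c • f', hf1.const_smul c, (Lp.coeFn_smul c f).trans (hf2.const_smul c), fun x hx => ?_⟩
  simp [hf3 hx]

/-- The boundary conditions `u = ψ₀` and `u_z = ψ₁` on `Γ`, `u = 0` on `∂Ω \ Γ`. -/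
def BdryData {b d ξ : ℝ} {m : ℕ} (u : Sob (box b d ξ) m) (ψ₀ ψ₁ : Space → ℂ) : Prop :=
  EqOnBdry (wderiv 0 u) (backFace b ξ) ψ₀ ∧ EqOnBdry (grad u 2) (backFace b ξ) ψ₁ ∧
    EqOnBdry (wderiv 0 u) (frontier (box b d ξ : Set Space) \ backFace b ξ) 0

theorem wderiv_add {Ω : TopologicalSpace.Opens Space} {m : ℕ} (α : Fin 3 → ℕ) (u v : Sob Ω m) :
    wderiv α (u + v) = wderiv α u + wderiv α v := by
  unfold wderiv
  split_ifs
  · rfl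
  · simp

theorem wderiv_smul {Ω : TopologicalSpace.Opens Space} {m : ℕ} (α : Fin 3 → ℕ) (c : ℝ)
    (u : Sob Ω m) : wderiv α (c • u) = c • wderiv α u := by
  unfold wderiv
  split_ifs
  · rfl
  · simp

theorem wderiv_zero {Ω : TopologicalSpace.Opens Space} {m : ℕ} (α : Fin 3 → ℕ) :
    wderiv α (0 : Sob Ω m) = 0 := by
  unfold wderiv
  split_ifs
  · rfl
  · simp

/-- `H^3_0(Ω) = {u ∈ H^3(Ω) : u = 0 on ∂Ω, u_z = 0 on Γ}`. -/
def sob30 (b d ξ : ℝ) : Submodule ℝ (Sob (box b d ξ) 3) where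
  carrier := {u | EqOnBdry (wderiv 0 u) (frontier (box b d ξ : Set Space)) 0 ∧
    EqOnBdry (grad u 2) (backFace b ξ) 0}
  zero_mem' := by
    simp only [grad, mem_ofPred_eq, wderiv_zero]
    exact ⟨EqOnBdry.zero _, EqOnBdry.zero _⟩
  add_mem' := by
    intro u v hu hv
    simp only [grad, mem_ofPred_eq, wderiv_add]
    exact ⟨hu.1.add hv.1, hu.2.add hv.2⟩
  smul_mem' := by
    intro c u hu
    simp only [grad, mem_ofPred_eq, wderiv_smul]
    exact ⟨hu.1.smul c, hu.2.smul c⟩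

/-! ### Functions of `(x, k)` -/

/-- `H_m = L²([k₁, k₂]; H^m(Ω))`, with `‖f‖² = ∫_{k₁}^{k₂} ‖f(·, k)‖²_{H^m(Ω)} dk`. -/
abbrev HK (Ω : TopologicalSpace.Opens Space) (k₁ k₂ : ℝ) (m : ℕ) : Type :=
  Lp (Sob Ω m) 2 (volume.restrict (Icc k₁ k₂))

/-- The subspace `H_3^0` of `H_3`: `f(·, k) = 0` on `∂Ω` and `f_z(·, k) = 0` on `Γ`. -/
def hk30 (b d ξ k₁ k₂ : ℝ) : Submodule ℝ (HK (box b d ξ) k₁ k₂ 3) where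
  carrier := {f | ∀ᵐ k ∂(volume.restrict (Icc k₁ k₂)), f k ∈ sob30 b d ξ}
  zero_mem' := by
    filter_upwards [Lp.coeFn_zero (Sob (box b d ξ) 3) 2 (volume.restrict (Icc k₁ k₂))] with k hk
    rw [hk]
    exact (sob30 b d ξ).zero_mem
  add_mem' := by
    intro f g hf hg
    filter_upwards [hf, hg, Lp.coeFn_add f g] with k h1 h2 h3
    rw [h3]
    exact (sob30 b d ξ).add_mem h1 h2
  smul_mem' := by
    intro c f hf
    filter_upwards [hf, Lp.coeFn_smul c f] with k h1 h2
    rw [h2]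
    exact (sob30 b d ξ).smul_mem c h1

/-- The inclusion `H_n ⊆ H_m` for `m ≤ n`. -/
def inclK (Ω : TopologicalSpace.Opens Space) (k₁ k₂ : ℝ) {m n : ℕ} (h : m ≤ n)
    (f : HK Ω k₁ k₂ n) : HK Ω k₁ k₂ m :=
  (incl Ω h).compLp f

/-! ### The functionals -/

/-- The Carleman weight function `φ_l(z) = exp(2 l (z + s)^{-ν})`. -/
def cwf (s ν l z : ℝ) : ℝ := Real.exp (2 * l * (z + s) ^ (-ν))

/-- The normalizing factor `exp(-2 l (s + d)^{-ν})`. -/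
def cwfNormalizer (s d ν l : ℝ) : ℝ := Real.exp (-2 * l * (s + d) ^ (-ν))

/-- `t_ν = (s - ξ)^{-ν} - (s + d)^{-ν}`. -/
def tNu (s d ξ ν : ℝ) : ℝ := (s - ξ) ^ (-ν) - (s + d) ^ (-ν)

/-- `I_{μ,α}(V) = exp(-2μ(s+d)^{-ν}) ∫_Ω |ΔV|² φ_μ(z) dx + α ‖V‖²_{H^3(Ω)}`. -/
def tailFunctional {b d ξ : ℝ} (s ν μ α : ℝ) (V : Sob (box b d ξ) 3) : ℝ :=
  cwfNormalizer s d ν μ * (∫ x in (box b d ξ : Set Space), ‖lap V x‖ ^ 2 * cwf s ν μ (x 2)) +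
    α * ‖V‖ ^ 2

/-- `V = W + Q`, where `W` minimizes `W ↦ I_{μ,α}(W + Q)` over `H^3_0(Ω)`. -/
def IsRegularizedTail {b d ξ : ℝ} (s ν μ α : ℝ) (Q V : Sob (box b d ξ) 3) : Prop :=
  ∃ W ∈ sob30 b d ξ, V = W + Q ∧
    IsMinOn (fun W' => tailFunctional s ν μ α (W' + Q)) (sob30 b d ξ) W

/-- The integro-differential operator
`L(q) = Δq + 2k (∇V - ∫_k^{k₂} ∇q dκ) · (k ∇q + ∇V - ∫_k^{k₂} ∇q dκ)
  + 2i (k q_z + V_z - ∫_k^{k₂} q_z dκ)` at the point `(x, k)`; the dot product is bilinear. -/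
def opL {Ω : TopologicalSpace.Opens Space} {k₁ k₂ : ℝ} (V : Sob Ω 3) (q : HK Ω k₁ k₂ 3)
    (k : ℝ) (x : Space) : ℂ :=
  lap (q k) x +
    2 * k * (∑ i : Fin 3,
      (grad V i x - grad (∫ κ in k..k₂, q κ) i x) *
        (k * grad (q k) i x + grad V i x - grad (∫ κ in k..k₂, q κ) i x)) +
    2 * Complex.I * (k * grad (q k) 2 x + grad V 2 x - grad (∫ κ in k..k₂, q κ) 2 x)

/-- The weighted residual `|L(p + F)(x, k)|² φ_l(z)²`. -/
def residual {b d ξ k₁ k₂ : ℝ} (s ν l : ℝ) (V : Sob (box b d ξ) 3)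
    (F : HK (box b d ξ) k₁ k₂ 4) (p : HK (box b d ξ) k₁ k₂ 3) (k : ℝ) (x : Space) : ℝ :=
  ‖opL V (p + inclK _ k₁ k₂ (by norm_num : 3 ≤ 4) F) k x‖ ^ 2 * cwf s ν l (x 2) ^ 2

/-- `J_{l,ρ}(p) = exp(-2l(s+d)^{-ν}) ∫_{k₁}^{k₂} ∫_Ω |L(p + F)|² φ_l² dx dκ + ρ ‖p‖²_{H_3}`,
where `L` contains the tail function `V`. -/
def functionalJ {b d ξ k₁ k₂ : ℝ} (s ν l ρ : ℝ) (V : Sob (box b d ξ) 3)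
    (F : HK (box b d ξ) k₁ k₂ 4) (p : HK (box b d ξ) k₁ k₂ 3) : ℝ :=
  cwfNormalizer s d ν l *
      (∫ κ in Icc k₁ k₂, ∫ x in (box b d ξ : Set Space), residual s ν l V F p κ x) +
    ρ * ‖p‖ ^ 2

end

end Convexification

namespace Convexification

noncomputable section

/-! ### Weak derivatives of weak derivatives -/

/-! The residual multiplied by the weight, `φ_λ L(p + F)`, is a polynomial of degree two in the pair
`z = (V, p + F)`: it equals `Λ z + B z z`, where `Λ` is linear and `B` bilinear, both bounded from
`H^3(Ω) × H_3` into `L²([k₁, k₂]; L²(Ω))`. Hence `J(p) = c ‖Λ z + B z z‖² + ρ ‖p‖²` is a continuous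
quartic polynomial in `p`. It is differentiable everywhere, and its derivative, of degree at most
three, is Lipschitz on bounded sets with a constant that depends on `c`, `ρ`, `‖Λ‖`, `‖B‖` and the
radius only (`exists_norm_quarticDeriv_sub_le`). Two points need work.

Boundedness of `B`. The product `∇u · ∇v` has to lie in `L²(Ω)`, so first derivatives of `H^3`
functions must be in `L⁴` (`exists_eLpNorm_grad_le`). A function with a weak derivative is, in the
almost everywhere sense, the integral of that derivative along lines
(`ae_sub_eq_integral_of_weakDeriv`). This gives a weighted one dimensional Sobolev inequality
(`lintegral_mul_sq_le_lineInt`), and using it along the three axes gives the `L⁴` bound. In the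
wavenumber, one factor of the product is bounded and the other is square integrable
(`exists_quadratic`).

Uniformity in `δ`. The radius must control `‖V‖`. Comparing the minimizer with the competitor `V_* -
Q_*` leaves only `Δ(Q - Q_*)`, of size `δ`, because `ΔV_* = 0`. The choice of `μ` keeps the
normalized weight below `1/δ`, so the minimum is `O(δ)`, while the penalty term makes it at least `δ
‖V‖²` (`norm_sq_regularizedTail_le`). -/

theorem partialDeriv_comm (i j : Fin 3) {φ : Space → ℝ} (h : ContDiff ℝ ∞ φ) :
    partialDeriv i (partialDeriv j φ) = partialDeriv j (partialDeriv i φ) := by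
  have hd : Differentiable ℝ (fderiv ℝ φ) :=
    (h.fderiv_right (m := ∞) (by norm_cast)).differentiable (by norm_num)
  have key : ∀ (k l : Fin 3) (x : Space), partialDeriv k (partialDeriv l φ) x =
      fderiv ℝ (fderiv ℝ φ) x (EuclideanSpace.single k 1) (EuclideanSpace.single l 1) := by
    intro k l x
    unfold partialDeriv
    rw [fderiv_clm_apply (hd x) (differentiableAt_const _)]
    simp
  funext x
  rw [key, key]
  exact (h.contDiffAt (x := x)).isSymmSndFDerivAt
    (by simp only [minSmoothness_of_isRCLikeNormedField]; exact WithTop.coe_le_coe.2 le_top) _ _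

theorem contDiff_iterate_partialDeriv (i : Fin 3) (n : ℕ) {φ : Space → ℝ}
    (h : ContDiff ℝ ∞ φ) : ContDiff ℝ ∞ ((partialDeriv i)^[n] φ) := by
  induction n generalizing φ with
  | zero => exact h
  | succ n ih => exact ih (partialDeriv_contDiff i h)

theorem iterate_partialDeriv_comm (i j : Fin 3) (n : ℕ) {φ : Space → ℝ} (h : ContDiff ℝ ∞ φ) :
    (partialDeriv i)^[n] (partialDeriv j φ) = partialDeriv j ((partialDeriv i)^[n] φ) := by
  induction n generalizing φ with
  | zero => rfl
  | succ n ih =>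
    rw [Function.iterate_succ_apply, Function.iterate_succ_apply, partialDeriv_comm i j h,
      ih (partialDeriv_contDiff i h)]

theorem multiDeriv_partialDeriv (α : Fin 3 → ℕ) (j : Fin 3) {φ : Space → ℝ}
    (h : ContDiff ℝ ∞ φ) :
    multiDeriv α (partialDeriv j φ) = multiDeriv (α + Pi.single j 1) φ := by
  unfold multiDeriv
  have h2 := contDiff_iterate_partialDeriv 2 (α 2) h
  have h1 := contDiff_iterate_partialDeriv 1 (α 1) h2
  fin_cases j
  · simp [iterate_partialDeriv_comm _ _ _ h, iterate_partialDeriv_comm _ _ _ h2,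
      iterate_partialDeriv_comm _ _ _ h1, Function.iterate_succ_apply]
  · simp [iterate_partialDeriv_comm _ _ _ h, Function.iterate_succ_apply]
  · simp [Function.iterate_succ_apply]

theorem multiDeriv_single (j : Fin 3) {φ : Space → ℝ} (h : ContDiff ℝ ∞ φ) :
    multiDeriv (Pi.single j 1) φ = partialDeriv j φ := by
  have := multiDeriv_partialDeriv 0 j h
  rw [zero_add] at this
  rw [← this]
  rfl

/-- The partial derivative of a test function. -/
def testPartial {Ω : TopologicalSpace.Opens Space} (j : Fin 3) (φ : 𝓓(Ω, ℝ)) : 𝓓(Ω, ℝ) where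
  toFun := partialDeriv j φ
  contDiff' := partialDeriv_contDiff j φ.contDiff
  hasCompactSupport' := φ.hasCompactSupport.fderiv_apply ℝ _
  tsupport_subset' := (tsupport_fderiv_apply_subset ℝ _).trans φ.tsupport_subset

theorem wderiv_of_mem {Ω : TopologicalSpace.Opens Space} {m : ℕ} {α : Fin 3 → ℕ}
    (h : α ∈ multiIdx m) (u : Sob Ω m) : wderiv α u = u.1 ⟨α, h⟩ := dif_pos h

theorem isWeakDeriv_wderiv {Ω : TopologicalSpace.Opens Space} {m : ℕ} {α : Fin 3 → ℕ}
    (h : α ∈ multiIdx m) (u : Sob Ω m) : IsWeakDeriv Ω α (wderiv 0 u) (wderiv α u) := by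
  have h0 : wderiv 0 u = u.1 (zeroIdx m) := wderiv_of_mem (zeroIdx m).2 u
  rw [wderiv_of_mem h, h0]
  exact u.2 ⟨α, h⟩

/-- The definition of `sobolev` relates every entry of a jet to `u` alone. Testing `∂^α u` with `∂_j
φ` and `∂^{α + e_j} u` with `φ` produces the same integral of `u` against `∂^{α + e_j} φ`, and
comparing the two relates consecutive entries. -/
theorem isWeakDeriv_wderiv_single {Ω : TopologicalSpace.Opens Space} {m : ℕ} {α : Fin 3 → ℕ}
    (j : Fin 3) (h : α + Pi.single j 1 ∈ multiIdx m) (u : Sob Ω m) :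
    IsWeakDeriv Ω (Pi.single j 1) (wderiv α u) (wderiv (α + Pi.single j 1) u) := by
  have hsum : ∑ i, (α + Pi.single j 1 : Fin 3 → ℕ) i = ∑ i, α i + 1 := by
    simp [Finset.sum_add_distrib]
  have hα : α ∈ multiIdx m := by
    rw [mem_multiIdx] at h ⊢
    omega
  intro φ
  have h1 := isWeakDeriv_wderiv hα u (testPartial j φ)
  have h2 := isWeakDeriv_wderiv h u φ
  have h3 : ((testPartial j φ : 𝓓(Ω, ℝ)) : Space → ℝ) = partialDeriv j φ := rfl
  rw [h3, multiDeriv_partialDeriv α j φ.contDiff, h2, hsum, pow_succ] at h1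
  rw [multiDeriv_single j φ.contDiff]
  have h4 : ((-1 : ℂ) ^ (∑ i, α i)) * (-1) ^ (∑ i, α i) = 1 := by
    rw [← mul_pow]; simp
  have h5 := congrArg (fun z => (-1 : ℂ) ^ (∑ i, α i) * z) h1
  simp only [← mul_assoc, h4, one_mul] at h5
  rw [← h5]
  simp

/-! ### The fundamental theorem of calculus along lines -/

/-- The `j`-th unit vector. -/
abbrev unitVec (j : Fin 3) : Space := EuclideanSpace.single j 1

/-- Supplies the integrability for Fubini below: by translation invariance the integral of `‖G‖`
over `x` is the same for every `t`, and `t` runs over a bounded interval. -/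
theorem integrable_translates {G : Space → ℂ} (hG : Integrable G) (hGm : StronglyMeasurable G)
    (e : Space) (a b : ℝ) :
    Integrable (fun q : Space × ℝ => G (q.1 + q.2 • e))
      (volume.prod (volume.restrict (uIoc a b))) := by
  have hm : StronglyMeasurable fun q : Space × ℝ => G (q.1 + q.2 • e) :=
    hGm.comp_measurable (by fun_prop)
  rw [integrable_prod_iff' hm.aestronglyMeasurable]
  refine ⟨.of_forall fun t => hG.comp_add_right (t • e), ?_⟩
  simp only [integral_add_right_eq_self (fun x => ‖G x‖)]
  exact integrableOn_const (by simp [uIoc])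

theorem hasDerivAt_line {φ : Space → ℝ} (h : ContDiff ℝ ∞ φ) (j : Fin 3) (x : Space) (τ : ℝ) :
    HasDerivAt (fun τ : ℝ => φ (x - τ • unitVec j)) (-partialDeriv j φ (x - τ • unitVec j)) τ := by
  have h1 : HasDerivAt (fun τ : ℝ => x - τ • unitVec j) (-unitVec j) τ := by
    simpa using ((hasDerivAt_id τ).smul_const (unitVec j)).const_sub x
  have h2 := ((h.differentiable (by norm_num)) (x - τ • unitVec j)).hasFDerivAt.comp_hasDerivAt τ h1
  rw [map_neg] at h2
  exact h2

/-- The difference of the two sides is tested with `φ` supported where both endpoints lie in `Ω`.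
Translations are moved onto `φ`, the weak derivative is tested with `φ(· - τe)`, and the
`τ`-integral of `-∂_j φ(x - τe)` is `φ(x - te) - φ(x)`. The fundamental lemma of the calculus of
variations concludes. The exceptional null set depends on `t`. -/
theorem ae_sub_eq_integral_of_weakDeriv {Ω : TopologicalSpace.Opens Space}
    (hΩ : Convex ℝ (Ω : Set Space)) (j : Fin 3) {F G : Space → ℂ}
    (hF : Integrable F)
    (hG : Integrable G) (hGm : StronglyMeasurable G)
    (h : ∀ φ : 𝓓(Ω, ℝ), ∫ x, F x * (partialDeriv j φ x : ℂ) = -∫ x, G x * (φ x : ℂ)) (t : ℝ) :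
    ∀ᵐ x, x ∈ Ω → x + t • unitVec j ∈ Ω →
      F (x + t • unitVec j) - F x = ∫ τ in (0 : ℝ)..t, G (x + τ • unitVec j) := by
  set e := unitVec j with he
  have hcont : Continuous fun x : Space => x + t • e := by fun_prop
  have hU : IsOpen ((Ω : Set Space) ∩ (fun x => x + t • e) ⁻¹' Ω) :=
    Ω.isOpen.inter (Ω.isOpen.preimage hcont)
  have hGi : Integrable fun x => ∫ τ in (0 : ℝ)..t, G (x + τ • e) := by
    simp only [intervalIntegral.intervalIntegral_eq_integral_uIoc]
    exact (integrable_translates hG hGm e 0 t).integral_prod_left.smul _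
  have hFt : Integrable fun x => F (x + t • e) := hF.comp_add_right _
  have hD : Integrable fun x => F (x + t • e) - F x - ∫ τ in (0 : ℝ)..t, G (x + τ • e) :=
    (hFt.sub hF).sub hGi
  have key : ∀ g : Space → ℝ, ContDiff ℝ ∞ g → HasCompactSupport g →
      tsupport g ⊆ (Ω : Set Space) ∩ (fun x => x + t • e) ⁻¹' Ω →
      ∫ x, g x • (F (x + t • e) - F x - ∫ τ in (0 : ℝ)..t, G (x + τ • e)) = 0 := by
    intro φ hφ hc hs
    obtain ⟨C, hC⟩ := hφ.continuous.bounded_above_of_compact_support hc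
    have hφ' : ContDiff ℝ ∞ (partialDeriv j φ) := partialDeriv_contDiff j hφ
    have hc' : HasCompactSupport (partialDeriv j φ) := hc.fderiv_apply ℝ _
    obtain ⟨C', hC'⟩ := hφ'.continuous.bounded_above_of_compact_support hc'
    have hφm : StronglyMeasurable φ := hφ.continuous.stronglyMeasurable
    have hbd : ∀ {H : Space → ℂ}, Integrable H → Integrable fun x => φ x • H x := fun hH =>
      hH.bdd_smul C hφm.aestronglyMeasurable (.of_forall hC)
    -- the weak derivative tested with translates
    have htrans : ∀ τ ∈ uIoc 0 t, ∫ x, φ x • G (x + τ • e) =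
        -∫ x, F x * (partialDeriv j φ (x - τ • e) : ℂ) := by
      intro τ hτ
      have ht0 : t ≠ 0 := by
        rintro rfl
        simp at hτ
      have hτt : τ / t ∈ Icc (0 : ℝ) 1 := by
        rcases lt_or_gt_of_ne ht0 with h0 | h0
        · rw [uIoc_of_ge h0.le] at hτ
          exact ⟨div_nonneg_of_nonpos hτ.2 h0.le, (div_le_one_of_neg h0).2 hτ.1.le⟩
        · rw [uIoc_of_le h0.le] at hτ
          exact ⟨div_nonneg hτ.1.le h0.le, (div_le_one h0).2 hτ.2⟩
      let ψ : 𝓓(Ω, ℝ) :=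
        { toFun := fun x => φ (x - τ • e)
          contDiff' := hφ.comp (contDiff_id.sub contDiff_const)
          hasCompactSupport' := by
            exact hc.comp_homeomorph (Homeomorph.subRight (τ • e))
          tsupport_subset' := by
            intro x hx
            have h1 : x - τ • e ∈ tsupport φ := by
              have := tsupport_comp_subset_preimage φ
                (f := fun x : Space => x - τ • e) (by fun_prop) hx
              exact this
            have h2 := hs h1
            -- Convexity: `x - τe` and `x - τe + te` are in `Ω`, and `x` divides the segment between
            -- them in the ratio given by `τ / t`. So the translate is a test function on `Ω`.
            have h3 := hΩ.add_smul_mem h2.1 h2.2 hτt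
            rw [smul_smul, div_mul_cancel₀ _ ht0, sub_add_cancel] at h3
            exact h3 }
      have hψ : partialDeriv j ψ = fun x => partialDeriv j φ (x - τ • e) := by
        funext x
        change fderiv ℝ (fun x => φ (x - τ • e)) x _ = _
        rw [fderiv_comp_sub]
        rfl
      have h1 := h ψ
      rw [hψ] at h1
      rw [h1, neg_neg, ← integral_add_right_eq_self (fun x => G x * (ψ x : ℂ)) (τ • e)]
      refine integral_congr_ae (.of_forall fun x => ?_)
      change φ x • G (x + τ • e) = G (x + τ • e) * (φ (x + τ • e - τ • e) : ℂ)
      rw [add_sub_cancel_right, mul_comm, Complex.real_smul]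
    have e1 : ∫ x, φ x • F (x + t • e) = ∫ x, φ (x - t • e) • F x := by
      rw [← integral_add_right_eq_self (fun x => φ (x - t • e) • F x) (t • e)]
      simp only [add_sub_cancel_right]
    have hi1 : Integrable (fun q : Space × ℝ => φ q.1 • G (q.1 + q.2 • e))
        (volume.prod (volume.restrict (uIoc 0 t))) :=
      (integrable_translates hG hGm e 0 t).bdd_smul C
        (hφm.comp_measurable measurable_fst).aestronglyMeasurable (.of_forall fun q => hC q.1)
    have hi2 : Integrable (fun q : Space × ℝ => F q.1 * (partialDeriv j φ (q.1 - q.2 • e) : ℂ))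
        (volume.prod (volume.restrict (uIoc 0 t))) := by
      have h0 : Integrable (fun q : Space × ℝ => F q.1)
          (volume.prod (volume.restrict (uIoc 0 t))) := by
        have : IsFiniteMeasure (volume.restrict (uIoc 0 t)) := ⟨by simp [uIoc]⟩
        exact hF.comp_fst _
      refine h0.mul_bdd (c := C') ?_ (.of_forall fun q => ?_)
      · exact (Complex.continuous_ofReal.comp
          (hφ'.continuous.comp (by fun_prop))).aestronglyMeasurable
      · simpa using hC' (q.1 - q.2 • e)
    have e2 : ∫ x, φ x • ∫ τ in (0 : ℝ)..t, G (x + τ • e) =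
        (∫ x, φ (x - t • e) • F x) - ∫ x, φ x • F x := by
      calc ∫ x, φ x • ∫ τ in (0 : ℝ)..t, G (x + τ • e)
          = ∫ x, ∫ τ in (0 : ℝ)..t, φ x • G (x + τ • e) := by
            simp only [intervalIntegral.integral_smul]
        _ = ∫ τ in (0 : ℝ)..t, ∫ x, φ x • G (x + τ • e) :=
            (intervalIntegral_integral_swap
              (f := fun τ x => φ x • G (x + τ • e)) hi1.swap).symm
        _ = ∫ τ in (0 : ℝ)..t, ∫ x, -(F x * (partialDeriv j φ (x - τ • e) : ℂ)) := by
            refine intervalIntegral.integral_congr_ae (.of_forall fun τ hτ => ?_)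
            simp only [htrans τ hτ, integral_neg]
        _ = ∫ x, ∫ τ in (0 : ℝ)..t, -(F x * (partialDeriv j φ (x - τ • e) : ℂ)) :=
            intervalIntegral_integral_swap
              (f := fun τ x => -(F x * (partialDeriv j φ (x - τ • e) : ℂ))) hi2.neg.swap
        _ = ∫ x, (φ (x - t • e) • F x - φ x • F x) := by
            refine integral_congr_ae (.of_forall fun x => ?_)
            have h1 : ∫ τ in (0 : ℝ)..t, ((-partialDeriv j φ (x - τ • e) : ℝ) : ℂ) =
                ((φ (x - t • e) - φ x : ℝ) : ℂ) := by
              rw [intervalIntegral.integral_ofReal]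
              congr 1
              have := intervalIntegral.integral_eq_sub_of_hasDerivAt (a := 0) (b := t)
                (fun τ _ => hasDerivAt_line hφ j x τ)
                (Continuous.intervalIntegrable
                  ((hφ'.continuous.comp (by fun_prop : Continuous fun τ : ℝ =>
                    x - τ • unitVec j)).neg) _ _)
              simpa using this
            have h2 : ∀ τ : ℝ, -(F x * (partialDeriv j φ (x - τ • e) : ℂ)) =
                F x * ((-partialDeriv j φ (x - τ • e) : ℝ) : ℂ) := by
              intro τ; push_cast; ring
            simp only [h2]
            rw [intervalIntegral.integral_const_mul, h1]
            simp only [Complex.real_smul]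
            push_cast
            ring
        _ = _ := by
            rw [integral_sub _ (hbd hF)]
            exact hF.bdd_smul C (hφ.continuous.comp (by fun_prop :
              Continuous fun x : Space => x - t • e)).aestronglyMeasurable
              (.of_forall fun x => hC _)
    simp only [smul_sub]
    have h3 : Integrable fun x => φ x • F (x + t • e) - φ x • F x := (hbd hFt).sub (hbd hF)
    rw [integral_sub h3 (hbd hGi), integral_sub (hbd hFt) (hbd hF), e1, e2]
    ring
  have := hU.ae_eq_zero_of_integral_contDiff_smul_eq_zero
    (hD.locallyIntegrable.locallyIntegrableOn _) key
  filter_upwards [this] with x hx h1 h2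
  exact sub_eq_zero.1 (hx ⟨h1, h2⟩)

open scoped ENNReal

/-! ### Integrals along lines -/

/-- The integral of `H` over the line through `x` in the direction of the `j`-th axis. -/
def lineInt (j : Fin 3) (H : Space → ℝ≥0∞) (x : Space) : ℝ≥0∞ := ∫⁻ t : ℝ, H (x + t • unitVec j)

theorem measurable_comp_line {H : Space → ℝ≥0∞} (hH : Measurable H) (j : Fin 3) :
    Measurable fun q : Space × ℝ => H (q.1 + q.2 • unitVec j) := hH.comp (by fun_prop)

theorem measurable_line {H : Space → ℝ≥0∞} (hH : Measurable H) (j : Fin 3) (x : Space) :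
    Measurable fun t : ℝ => H (x + t • unitVec j) := hH.comp (by fun_prop)

theorem measurable_lineInt (j : Fin 3) {H : Space → ℝ≥0∞} (hH : Measurable H) :
    Measurable (lineInt j H) := (measurable_comp_line hH j).lintegral_prod_right'

theorem lineInt_add (j : Fin 3) {H K : Space → ℝ≥0∞} (hH : Measurable H) :
    lineInt j (fun x => H x + K x) = fun x => lineInt j H x + lineInt j K x := by
  funext x
  exact lintegral_add_left (measurable_line hH j x) _

/-- Integration over parallel lines is a symmetric operator: translate `x` by `-t e_j`, then reflect
`t`. -/
theorem lintegral_mul_lineInt (j : Fin 3) {H K : Space → ℝ≥0∞} (hH : Measurable H)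
    (hK : Measurable K) :
    ∫⁻ x, H x * lineInt j K x = ∫⁻ x, lineInt j H x * K x := by
  have hm : ∀ {A B : Space → ℝ≥0∞}, Measurable A → Measurable B →
      Measurable fun q : Space × ℝ => A q.1 * B (q.1 + q.2 • unitVec j) := fun hA hB =>
    (hA.comp measurable_fst).mul (measurable_comp_line hB j)
  calc ∫⁻ x, H x * lineInt j K x
      = ∫⁻ x, ∫⁻ t : ℝ, H x * K (x + t • unitVec j) := by
        refine lintegral_congr fun x => ?_
        rw [lineInt, lintegral_const_mul _ (measurable_line hK j x)]
    _ = ∫⁻ t : ℝ, ∫⁻ x, H x * K (x + t • unitVec j) :=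
        lintegral_lintegral_swap (hm hH hK).aemeasurable
    _ = ∫⁻ t : ℝ, ∫⁻ x, K x * H (x + (-t) • unitVec j) := by
        refine lintegral_congr fun t => ?_
        rw [← lintegral_add_right_eq_self (fun x => K x * H (x + (-t) • unitVec j))
          (t • unitVec j)]
        refine lintegral_congr fun x => ?_
        rw [mul_comm, neg_smul, add_neg_cancel_right]
    _ = ∫⁻ t : ℝ, ∫⁻ x, K x * H (x + t • unitVec j) := by
        exact lintegral_neg_eq_self (fun t : ℝ => ∫⁻ x, K x * H (x + t • unitVec j))
    _ = ∫⁻ x, ∫⁻ t : ℝ, K x * H (x + t • unitVec j) :=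
        (lintegral_lintegral_swap (hm hK hH).aemeasurable).symm
    _ = _ := by
        refine lintegral_congr fun x => ?_
        rw [lintegral_const_mul _ (measurable_line hH j x), mul_comm, lineInt]

/-- The base point only shifts the variable of integration, so a line integral is the marginal in
the `j`-th coordinate. -/
theorem lineInt_comp_toLp (j : Fin 3) (H : Space → ℝ≥0∞) :
    (fun x : Fin 3 → ℝ => lineInt j H (WithLp.toLp 2 x)) =
      ∫⋯∫⁻_{j}, (fun x : Fin 3 → ℝ => H (WithLp.toLp 2 x)) ∂(fun _ => volume) := by
  rw [lmarginal_singleton]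
  funext x
  rw [← lintegral_add_left_eq_self _ (x j), lineInt]
  refine lintegral_congr fun t => congrArg H ?_
  ext i
  by_cases h : i = j
  · subst h; simp
  · simp [h]

/-- Tonelli. The order 1, 0, 2 is the one in which the line integrals pile up in
`exists_lintegral_pow_four_le`. -/
theorem lineInt_lineInt_lineInt {H : Space → ℝ≥0∞} (hH : Measurable H) (x : Space) :
    lineInt 1 (lineInt 0 (lineInt 2 H)) x = ∫⁻ y, H y := by
  have hm : Measurable fun x : Fin 3 → ℝ => H (WithLp.toLp 2 x) := hH.comp (by fun_prop)
  have h1 : (fun x : Fin 3 → ℝ => lineInt 1 (lineInt 0 (lineInt 2 H)) (WithLp.toLp 2 x)) =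
      ∫⋯∫⁻_Finset.univ, (fun x : Fin 3 → ℝ => H (WithLp.toLp 2 x)) ∂(fun _ => volume) := by
    have hu : (Finset.univ : Finset (Fin 3)) = {1} ∪ ({0} ∪ {2}) := by decide
    rw [lineInt_comp_toLp, lineInt_comp_toLp, lineInt_comp_toLp, hu,
      lmarginal_union _ _ hm (by decide), lmarginal_union _ _ hm (by decide)]
  have h2 := congrFun h1 (WithLp.ofLp x)
  rw [← lintegral_eq_lmarginal_univ] at h2
  rw [show lineInt 1 (lineInt 0 (lineInt 2 H)) x = _ from h2]
  exact (PiLp.volume_preserving_toLp (Fin 3)).lintegral_comp hH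

theorem sq_lintegral_le {α : Type*} [MeasurableSpace α] (μ : Measure α) {h : α → ℝ≥0∞}
    (hh : AEMeasurable h μ) : (∫⁻ a, h a ∂μ) ^ 2 ≤ μ univ * ∫⁻ a, h a ^ 2 ∂μ := by
  have h1 := ENNReal.lintegral_mul_le_Lp_mul_Lq μ Real.HolderConjugate.two_two
    (aemeasurable_const (b := (1 : ℝ≥0∞))) hh
  have h2 : ∀ c : ℝ≥0∞, (c ^ (1 / 2 : ℝ)) ^ 2 = c := by
    intro c
    rw [← ENNReal.rpow_natCast, ← ENNReal.rpow_mul]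
    norm_num
  calc (∫⁻ a, h a ∂μ) ^ 2 ≤ _ := by
        refine pow_le_pow_left' (le_trans (le_of_eq ?_) h1) 2
        simp
    _ = _ := by
        rw [mul_pow, h2, h2]
        simp

theorem add_sq_le_two_mul (a b : ℝ≥0∞) : (a + b) ^ 2 ≤ 2 * a ^ 2 + 2 * b ^ 2 := by
  have := ENNReal.rpow_add_le_mul_rpow_add_rpow a b (p := 2) (by norm_num)
  norm_num at this
  rwa [mul_add] at this

/-- The weighted one dimensional Sobolev inequality on the lines parallel to the `j`-th axis. -/
theorem lintegral_mul_sq_le_lineInt {Ω : Set Space} (hΩ : MeasurableSet Ω) (j : Fin 3) {l : ℝ≥0∞}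
    (hl0 : l ≠ 0) (hl : l ≠ ⊤)
    (hle : ∀ x, volume {t : ℝ | x + t • unitVec j ∈ Ω} ≤ l)
    (heq : ∀ x ∈ Ω, volume {t : ℝ | x + t • unitVec j ∈ Ω} = l)
    {F G : Space → ℂ} (hF : Measurable F) (hG : Measurable G)
    (hF0 : ∀ x ∉ Ω, F x = 0) (hG0 : ∀ x ∉ Ω, G x = 0)
    (h : ∀ t : ℝ, ∀ᵐ x, x ∈ Ω → x + t • unitVec j ∈ Ω →
      F (x + t • unitVec j) - F x = ∫ τ in (0 : ℝ)..t, G (x + τ • unitVec j))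
    {H : Space → ℝ≥0∞} (hH : Measurable H) :
    ∫⁻ x, H x * ‖F x‖ₑ ^ 2 ≤ l⁻¹ * (2 + 2 * l * l) *
      ∫⁻ x, H x * lineInt j (fun y => ‖F y‖ₑ ^ 2 + ‖G y‖ₑ ^ 2) x := by
  set e := unitVec j with he
  have hF2 : Measurable fun x => ‖F x‖ₑ ^ 2 := by fun_prop
  have hG2 : Measurable fun x => ‖G x‖ₑ ^ 2 := by fun_prop
  have hS : ∀ x, MeasurableSet {t : ℝ | x + t • e ∈ Ω} := fun x =>
    hΩ.preimage (f := fun t : ℝ => x + t • e) (by fun_prop)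
  have hI : Measurable (Ω.indicator (1 : Space → ℝ≥0∞)) := measurable_one.indicator hΩ
  have hIint : ∀ x, ∫⁻ t : ℝ, Ω.indicator (1 : Space → ℝ≥0∞) (x + t • e) =
      volume {t : ℝ | x + t • e ∈ Ω} := by
    intro x
    rw [← lintegral_indicator_one (hS x)]
    rfl
  -- the increments of `F` along the line
  have hinc : ∀ x t, ‖∫ τ in (0 : ℝ)..t, G (x + τ • e)‖ₑ ^ 2 ≤
      l * lineInt j (fun y => ‖G y‖ₑ ^ 2) x := by
    intro x t
    have h1 : ‖∫ τ in (0 : ℝ)..t, G (x + τ • e)‖ₑ ≤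
        ∫⁻ τ in {t : ℝ | x + t • e ∈ Ω}, ‖G (x + τ • e)‖ₑ := by
      rw [setLIntegral_eq_of_support_subset]
      · calc ‖∫ τ in (0 : ℝ)..t, G (x + τ • e)‖ₑ
            = ‖∫ τ in uIoc 0 t, G (x + τ • e)‖ₑ := by
              rw [← ofReal_norm, intervalIntegral.norm_intervalIntegral_eq, ofReal_norm]
          _ ≤ ∫⁻ τ in uIoc 0 t, ‖G (x + τ • e)‖ₑ := enorm_integral_le_lintegral_enorm _
          _ ≤ _ := setLIntegral_le_lintegral _ _
      · intro τ hτ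
        by_contra hn
        exact hτ (by simp [hG0 _ hn])
    calc ‖∫ τ in (0 : ℝ)..t, G (x + τ • e)‖ₑ ^ 2
        ≤ (∫⁻ τ in {t : ℝ | x + t • e ∈ Ω}, ‖G (x + τ • e)‖ₑ) ^ 2 := pow_le_pow_left' h1 2
      _ ≤ _ := sq_lintegral_le _ (by fun_prop)
      _ ≤ _ := by
        rw [Measure.restrict_apply_univ]
        exact mul_le_mul' (hle x) (setLIntegral_le_lintegral _ _)
  -- The indicator keeps only those `t` for which the increment formula is available; otherwise both
  -- sides vanish.
  have hpt : ∀ t : ℝ, ∀ᵐ x, Ω.indicator (1 : Space → ℝ≥0∞) (x + t • e) * (H x * ‖F x‖ₑ ^ 2) ≤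
      Ω.indicator 1 (x + t • e) * (H x * (2 * ‖F (x + t • e)‖ₑ ^ 2 +
        2 * (l * lineInt j (fun y => ‖G y‖ₑ ^ 2) x))) := by
    intro t
    filter_upwards [h t] with x hx
    by_cases hx1 : x ∈ Ω
    · by_cases hx2 : x + t • e ∈ Ω
      · refine mul_le_mul_right (mul_le_mul_right ?_ _) _
        have h1 : F x = F (x + t • e) - ∫ τ in (0 : ℝ)..t, G (x + τ • e) := by
          rw [← hx hx1 hx2]; ring
        calc ‖F x‖ₑ ^ 2
            ≤ (‖F (x + t • e)‖ₑ + ‖∫ τ in (0 : ℝ)..t, G (x + τ • e)‖ₑ) ^ 2 := by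
              refine pow_le_pow_left' ?_ 2
              conv_lhs => rw [h1]
              exact enorm_sub_le
          _ ≤ _ := (add_sq_le_two_mul _ _).trans (by gcongr; exact hinc x t)
      · simp [hx2]
    · simp [hF0 x hx1]
  have hm1 : Measurable fun q : Space × ℝ =>
      Ω.indicator (1 : Space → ℝ≥0∞) (q.1 + q.2 • e) * (H q.1 * ‖F q.1‖ₑ ^ 2) :=
    (measurable_comp_line hI j).mul ((hH.mul hF2).comp measurable_fst)
  have hm2 : Measurable fun q : Space × ℝ =>
      Ω.indicator (1 : Space → ℝ≥0∞) (q.1 + q.2 • e) * (H q.1 * (2 * ‖F (q.1 + q.2 • e)‖ₑ ^ 2 +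
        2 * (l * lineInt j (fun y => ‖G y‖ₑ ^ 2) q.1))) :=
    (measurable_comp_line hI j).mul ((hH.comp measurable_fst).mul
      (((measurable_comp_line hF2 j).const_mul 2).add
        ((((measurable_lineInt j hG2).comp measurable_fst).const_mul l).const_mul 2)))
  -- For `x ∈ Ω` the factor `l` is the integral of the indicator over the slice, so `F x` is
  -- compared with all `F (x + t • e)` on its line. The increment formula holds for almost every `x`
  -- at fixed `t`, hence the order of integration is exchanged before it is used and restored
  -- afterwards.
  have hmain : l * ∫⁻ x, H x * ‖F x‖ₑ ^ 2 ≤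
      (2 + 2 * l * l) * ∫⁻ x, H x * lineInt j (fun y => ‖F y‖ₑ ^ 2 + ‖G y‖ₑ ^ 2) x := by
    calc l * ∫⁻ x, H x * ‖F x‖ₑ ^ 2
        = ∫⁻ x, l * (H x * ‖F x‖ₑ ^ 2) := (lintegral_const_mul _ (hH.mul hF2)).symm
      _ = ∫⁻ x, ∫⁻ t : ℝ, Ω.indicator (1 : Space → ℝ≥0∞) (x + t • e) * (H x * ‖F x‖ₑ ^ 2) := by
          refine lintegral_congr fun x => ?_
          rw [lintegral_mul_const _ (measurable_line hI j x), hIint]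
          by_cases hx : x ∈ Ω
          · rw [heq x hx]
          · simp [hF0 x hx]
      _ = ∫⁻ t : ℝ, ∫⁻ x, Ω.indicator (1 : Space → ℝ≥0∞) (x + t • e) * (H x * ‖F x‖ₑ ^ 2) :=
          lintegral_lintegral_swap hm1.aemeasurable
      _ ≤ ∫⁻ t : ℝ, ∫⁻ x, Ω.indicator 1 (x + t • e) * (H x * (2 * ‖F (x + t • e)‖ₑ ^ 2 +
            2 * (l * lineInt j (fun y => ‖G y‖ₑ ^ 2) x))) :=
          lintegral_mono fun t => lintegral_mono_ae (hpt t)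
      _ = ∫⁻ x, ∫⁻ t : ℝ, Ω.indicator 1 (x + t • e) * (H x * (2 * ‖F (x + t • e)‖ₑ ^ 2 +
            2 * (l * lineInt j (fun y => ‖G y‖ₑ ^ 2) x))) :=
          (lintegral_lintegral_swap hm2.aemeasurable).symm
      _ ≤ ∫⁻ x, (2 + 2 * l * l) * (H x * lineInt j (fun y => ‖F y‖ₑ ^ 2 + ‖G y‖ₑ ^ 2) x) := by
          refine lintegral_mono fun x => ?_
          calc _ = ∫⁻ t : ℝ, H x * (2 * (Ω.indicator 1 (x + t • e) * ‖F (x + t • e)‖ₑ ^ 2) +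
                Ω.indicator 1 (x + t • e) * (2 * (l * lineInt j (fun y => ‖G y‖ₑ ^ 2) x))) := by
                refine lintegral_congr fun t => ?_
                ring
            _ ≤ ∫⁻ t : ℝ, H x * (2 * ‖F (x + t • e)‖ₑ ^ 2 +
                Ω.indicator 1 (x + t • e) * (2 * (l * lineInt j (fun y => ‖G y‖ₑ ^ 2) x))) := by
                refine lintegral_mono fun t => ?_
                gcongr
                refine mul_le_of_le_one_left' ?_
                exact indicator_le_self' (fun _ _ => zero_le_one) _
            _ = H x * (2 * lineInt j (fun y => ‖F y‖ₑ ^ 2) x + volume {t : ℝ | x + t • e ∈ Ω} *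
                (2 * (l * lineInt j (fun y => ‖G y‖ₑ ^ 2) x))) := by
                have hm3 : Measurable fun t : ℝ => 2 * ‖F (x + t • e)‖ₑ ^ 2 +
                    Ω.indicator (1 : Space → ℝ≥0∞) (x + t • e) *
                      (2 * (l * lineInt j (fun y => ‖G y‖ₑ ^ 2) x)) :=
                  ((measurable_line hF2 j x).const_mul 2).add ((measurable_line hI j x).mul_const _)
                rw [lintegral_const_mul _ hm3,
                  lintegral_add_left ((measurable_line hF2 j x).const_mul 2),
                  lintegral_const_mul _ (measurable_line hF2 j x),
                  lintegral_mul_const _ (measurable_line hI j x), hIint]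
                rfl
            _ ≤ H x * (2 * lineInt j (fun y => ‖F y‖ₑ ^ 2) x + l *
                (2 * (l * lineInt j (fun y => ‖G y‖ₑ ^ 2) x))) := by
                gcongr
                exact hle x
            _ ≤ H x * ((2 + 2 * l * l) * lineInt j (fun y => ‖F y‖ₑ ^ 2) x +
                (2 + 2 * l * l) * lineInt j (fun y => ‖G y‖ₑ ^ 2) x) := by
                refine mul_le_mul_right (add_le_add (mul_le_mul_left le_self_add _) ?_) _
                rw [show l * (2 * (l * lineInt j (fun y => ‖G y‖ₑ ^ 2) x)) =
                  2 * l * l * lineInt j (fun y => ‖G y‖ₑ ^ 2) x by ring]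
                exact mul_le_mul_left le_add_self _
            _ = _ := by
                rw [lineInt_add j hF2]
                ring
      _ = _ := lintegral_const_mul _ (hH.mul (measurable_lineInt j (hF2.add hG2)))
  calc ∫⁻ x, H x * ‖F x‖ₑ ^ 2 = l⁻¹ * (l * ∫⁻ x, H x * ‖F x‖ₑ ^ 2) := by
        rw [← mul_assoc, ENNReal.inv_mul_cancel hl0 hl, one_mul]
    _ ≤ _ := by
        rw [mul_assoc]
        gcongr

/-! ### First order derivatives of functions in `H^3` of a box are in `L^4` -/

theorem norm_wderiv_le {Ω : TopologicalSpace.Opens Space} {m : ℕ} (α : Fin 3 → ℕ) (u : Sob Ω m) :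
    ‖wderiv α u‖ ≤ ‖u‖ := by
  by_cases h : α ∈ multiIdx m
  · rw [wderiv_of_mem h]
    exact PiLp.norm_apply_le (p := 2) (show Jet Ω m from u.1) ⟨α, h⟩
  · rw [wderiv, dif_neg h, norm_zero]
    exact norm_nonneg _

/-- The extension of `f ∈ L²(Ω)` by zero. -/
def zeroExt {Ω : TopologicalSpace.Opens Space} (f : L2 Ω) : Space → ℂ :=
  (Ω : Set Space).indicator f

theorem stronglyMeasurable_zeroExt {Ω : TopologicalSpace.Opens Space} (f : L2 Ω) :
    StronglyMeasurable (zeroExt f) := (Lp.stronglyMeasurable f).indicator Ω.isOpen.measurableSet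

theorem zeroExt_of_notMem {Ω : TopologicalSpace.Opens Space} (f : L2 Ω) :
    ∀ x ∉ (Ω : Set Space), zeroExt f x = 0 := fun _ hx => indicator_of_notMem hx _

theorem lintegral_enorm_zeroExt_pow {Ω : TopologicalSpace.Opens Space} (f : L2 Ω) {n : ℕ}
    (hn : n ≠ 0) : ∫⁻ x, ‖zeroExt f x‖ₑ ^ n =
      eLpNorm f n (volume.restrict (Ω : Set Space)) ^ n := by
  have h1 := eLpNorm_nnreal_pow_eq_lintegral (μ := volume.restrict (Ω : Set Space))
    (f := (f : Space → ℂ)) (p := n) (by exact_mod_cast hn)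
  simp only [NNReal.coe_natCast, ENNReal.rpow_natCast, ENNReal.coe_natCast] at h1
  rw [h1, ← lintegral_indicator Ω.isOpen.measurableSet]
  refine lintegral_congr fun x => ?_
  by_cases hx : x ∈ (Ω : Set Space)
  · simp [zeroExt, hx]
  · simp [zeroExt, hx, hn]

theorem lintegral_enorm_zeroExt_sq {Ω : TopologicalSpace.Opens Space} (f : L2 Ω) :
    ∫⁻ x, ‖zeroExt f x‖ₑ ^ 2 = ‖f‖ₑ ^ 2 := by
  rw [lintegral_enorm_zeroExt_pow f two_ne_zero, Lp.enorm_def]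
  rfl

/-- The lower ends of the sides of the box. -/
def boxLo (b ξ : ℝ) : Fin 3 → ℝ := ![-b, -b, -ξ]

/-- The upper ends of the sides of the box. -/
def boxHi (b d : ℝ) : Fin 3 → ℝ := ![b, b, d]

theorem mem_box_iff {b d ξ : ℝ} {x : Space} :
    x ∈ (box b d ξ : Set Space) ↔ ∀ i, x i ∈ Ioo (boxLo b ξ i) (boxHi b d i) := by
  change |x 0| < b ∧ |x 1| < b ∧ -ξ < x 2 ∧ x 2 < d ↔ _
  simp [Fin.forall_fin_succ, boxLo, boxHi, abs_lt]

theorem boxLo_lt_boxHi {b d ξ : ℝ} (hb : 0 < b) (hd : 0 < d) (hξ : 0 < ξ) (i : Fin 3) :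
    boxLo b ξ i < boxHi b d i := by
  fin_cases i <;> simp [boxLo, boxHi] <;> linarith

theorem convex_box (b d ξ : ℝ) : Convex ℝ (box b d ξ : Set Space) := by
  intro x hx y hy s t hs ht hst
  rw [mem_box_iff] at *
  intro i
  exact convex_Ioo _ _ (hx i) (hy i) hs ht hst

theorem isBounded_box (b d ξ : ℝ) : Bornology.IsBounded (box b d ξ : Set Space) := by
  have h1 : Bornology.IsBounded (univ.pi fun i => Ioo (boxLo b ξ i) (boxHi b d i)) :=
    .pi fun i => Metric.isBounded_Ioo _ _
  refine ((PiLp.antilipschitzWith_ofLp 2 (fun _ : Fin 3 => ℝ)).isBounded_preimage h1).subset ?_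
  intro x hx i _
  exact mem_box_iff.1 hx i

theorem volume_box_lt_top (b d ξ : ℝ) : volume (box b d ξ : Set Space) < ⊤ :=
  (isBounded_box b d ξ).measure_lt_top

instance isFiniteMeasure_box (b d ξ : ℝ) :
    IsFiniteMeasure (volume.restrict (box b d ξ : Set Space)) :=
  ⟨by rw [Measure.restrict_apply_univ]; exact volume_box_lt_top b d ξ⟩

theorem volume_line_box_le (b d ξ : ℝ) (j : Fin 3) (x : Space) :
    volume {t : ℝ | x + t • unitVec j ∈ (box b d ξ : Set Space)} ≤
      ENNReal.ofReal (boxHi b d j - boxLo b ξ j) := by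
  refine (measure_mono (t := Ioo (boxLo b ξ j - x j) (boxHi b d j - x j)) ?_).trans ?_
  · intro t ht
    have := mem_box_iff.1 ht j
    simp at this
    constructor <;> linarith [this.1, this.2]
  · rw [Real.volume_Ioo]
    exact ENNReal.ofReal_le_ofReal (by linarith)

theorem volume_line_box (b d ξ : ℝ) (j : Fin 3) {x : Space} (hx : x ∈ (box b d ξ : Set Space)) :
    volume {t : ℝ | x + t • unitVec j ∈ (box b d ξ : Set Space)} =
      ENNReal.ofReal (boxHi b d j - boxLo b ξ j) := by
  refine (volume_line_box_le b d ξ j x).antisymm ?_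
  refine le_trans (le_of_eq ?_)
    (measure_mono (s := Ioo (boxLo b ξ j - x j) (boxHi b d j - x j)) ?_)
  · rw [Real.volume_Ioo]
    congr 1
    ring
  · intro t ht
    refine mem_box_iff.2 fun i => ?_
    by_cases hi : i = j
    · subst hi
      simp
      constructor <;> linarith [ht.1, ht.2]
    · simpa [hi] using mem_box_iff.1 hx i

theorem integrable_zeroExt {b d ξ : ℝ} (f : L2 (box b d ξ)) : Integrable (zeroExt f) := by
  rw [zeroExt, integrable_indicator_iff (box b d ξ).isOpen.measurableSet]
  exact (Lp.memLp f).integrable (by norm_num)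

/-- All nonempty slices of a box in one axis direction have the same length. Extending by zero
creates no spurious derivative on the boundary, since the increment formula is used only between two
points of the box. -/
theorem exists_lintegral_mul_sq_le {b d ξ : ℝ} (hb : 0 < b) (hd : 0 < d) (hξ : 0 < ξ)
    (j : Fin 3) : ∃ C : ℝ≥0∞, C ≠ ⊤ ∧ ∀ f g : L2 (box b d ξ),
      IsWeakDeriv (box b d ξ) (Pi.single j 1) f g → ∀ H : Space → ℝ≥0∞, Measurable H →
      ∫⁻ x, H x * ‖zeroExt f x‖ₑ ^ 2 ≤
        C * ∫⁻ x, H x * lineInt j (fun y => ‖zeroExt f y‖ₑ ^ 2 + ‖zeroExt g y‖ₑ ^ 2) x := by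
  set l := ENNReal.ofReal (boxHi b d j - boxLo b ξ j) with hl
  have hl0 : l ≠ 0 := by
    rw [hl, Ne, ENNReal.ofReal_eq_zero, not_le, sub_pos]
    exact boxLo_lt_boxHi hb hd hξ j
  have hlt : l ≠ ⊤ := ENNReal.ofReal_ne_top
  refine ⟨l⁻¹ * (2 + 2 * l * l), by finiteness, fun f g hfg H hH => ?_⟩
  refine lintegral_mul_sq_le_lineInt (box b d ξ).isOpen.measurableSet j hl0 hlt
    (volume_line_box_le b d ξ j) (fun x hx => volume_line_box b d ξ j hx)
    (stronglyMeasurable_zeroExt f).measurable (stronglyMeasurable_zeroExt g).measurable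
    (zeroExt_of_notMem f) (zeroExt_of_notMem g) (fun t => ?_) hH
  refine ae_sub_eq_integral_of_weakDeriv (convex_box b d ξ) j (integrable_zeroExt f)
    (integrable_zeroExt g) (stronglyMeasurable_zeroExt g) (fun φ => ?_) t
  have hext : ∀ (h : L2 (box b d ξ)) (ψ : Space → ℂ), ∫ x, zeroExt h x * ψ x =
      ∫ x in (box b d ξ : Set Space), h x * ψ x := by
    intro h ψ
    rw [← integral_indicator (box b d ξ).isOpen.measurableSet]
    refine integral_congr_ae (.of_forall fun x => ?_)
    by_cases hx : x ∈ (box b d ξ : Set Space) <;> simp [zeroExt, hx]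
  have h1 := hfg φ
  rw [multiDeriv_single j φ.contDiff] at h1
  rw [hext f, hext g, h1]
  simp

/-- An argument of Gagliardo type. Write `|f|⁴ = |f|² |f|²` and regard one factor as the weight. The
inequality along axis 2 turns the other factor into a line integral, which becomes the next weight.
Axes 0 and 1 are then applied to the remaining `|f|²`, each line integral being moved onto the
weight by symmetry, until the weight is a constant, the full integral of `|f|² + |f₂|²`. Only `f`
and its derivative along axis 0 meet the last step, so `f₀₁` is the only second derivative needed.
-/
theorem exists_lintegral_pow_four_le {b d ξ : ℝ} (hb : 0 < b) (hd : 0 < d) (hξ : 0 < ξ) :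
    ∃ C : ℝ≥0∞, C ≠ ⊤ ∧ ∀ f f₀ f₁ f₂ f₀₁ : L2 (box b d ξ),
      IsWeakDeriv (box b d ξ) (Pi.single 0 1) f f₀ →
      IsWeakDeriv (box b d ξ) (Pi.single 1 1) f f₁ →
      IsWeakDeriv (box b d ξ) (Pi.single 2 1) f f₂ →
      IsWeakDeriv (box b d ξ) (Pi.single 1 1) f₀ f₀₁ →
      ∫⁻ x, ‖zeroExt f x‖ₑ ^ 4 ≤
        C * ((‖f‖ₑ ^ 2 + ‖f₂‖ₑ ^ 2) * (‖f‖ₑ ^ 2 + ‖f₁‖ₑ ^ 2 + (‖f₀‖ₑ ^ 2 + ‖f₀₁‖ₑ ^ 2))) := by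
  obtain ⟨C₀, hC₀, h0⟩ := exists_lintegral_mul_sq_le hb hd hξ 0
  obtain ⟨C₁, hC₁, h1⟩ := exists_lintegral_mul_sq_le hb hd hξ 1
  obtain ⟨C₂, hC₂, h2⟩ := exists_lintegral_mul_sq_le hb hd hξ 2
  refine ⟨C₂ * (C₀ * C₁), by finiteness, fun f f₀ f₁ f₂ f₀₁ hf0 hf1 hf2 hf01 => ?_⟩
  have hm : ∀ g : L2 (box b d ξ), Measurable fun x => ‖zeroExt g x‖ₑ ^ 2 := fun g =>
    (stronglyMeasurable_zeroExt g).measurable.enorm.pow_const 2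
  have hm2 : ∀ g h : L2 (box b d ξ), Measurable fun x => ‖zeroExt g x‖ₑ ^ 2 + ‖zeroExt h x‖ₑ ^ 2 :=
    fun g h => (hm g).add (hm h)
  have hi2 : ∀ g h : L2 (box b d ξ), ∫⁻ x, (‖zeroExt g x‖ₑ ^ 2 + ‖zeroExt h x‖ₑ ^ 2) =
      ‖g‖ₑ ^ 2 + ‖h‖ₑ ^ 2 := fun g h => by
    rw [lintegral_add_left (hm g), lintegral_enorm_zeroExt_sq, lintegral_enorm_zeroExt_sq]
  set a : Space → ℝ≥0∞ := fun x => ‖zeroExt f x‖ₑ ^ 2 + ‖zeroExt f₂ x‖ₑ ^ 2 with ha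
  have hma : Measurable a := hm2 f f₂
  have hP : Measurable (lineInt 2 a) := measurable_lineInt 2 hma
  have hPP : Measurable (lineInt 0 (lineInt 2 a)) := measurable_lineInt 0 hP
  have hlast : ∀ g g₁ : L2 (box b d ξ), IsWeakDeriv (box b d ξ) (Pi.single 1 1) g g₁ →
      ∫⁻ x, lineInt 0 (lineInt 2 a) x * ‖zeroExt g x‖ₑ ^ 2 ≤
        C₁ * ((‖f‖ₑ ^ 2 + ‖f₂‖ₑ ^ 2) * (‖g‖ₑ ^ 2 + ‖g₁‖ₑ ^ 2)) := by
    intro g g₁ hg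
    refine (h1 g g₁ hg _ hPP).trans ?_
    rw [lintegral_mul_lineInt 1 hPP (hm2 g g₁)]
    simp only [lineInt_lineInt_lineInt hma]
    rw [lintegral_const_mul _ (hm2 g g₁), hi2, hi2]
  calc ∫⁻ x, ‖zeroExt f x‖ₑ ^ 4 = ∫⁻ x, ‖zeroExt f x‖ₑ ^ 2 * ‖zeroExt f x‖ₑ ^ 2 := by
        refine lintegral_congr fun x => ?_
        ring
    _ ≤ C₂ * ∫⁻ x, ‖zeroExt f x‖ₑ ^ 2 * lineInt 2 a x := h2 f f₂ hf2 _ (hm f)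
    _ = C₂ * ∫⁻ x, lineInt 2 a x * ‖zeroExt f x‖ₑ ^ 2 := by simp only [mul_comm]
    _ ≤ C₂ * (C₀ * ∫⁻ x, lineInt 2 a x *
          lineInt 0 (fun y => ‖zeroExt f y‖ₑ ^ 2 + ‖zeroExt f₀ y‖ₑ ^ 2) x) :=
        mul_le_mul_right (h0 f f₀ hf0 _ hP) _
    _ = C₂ * (C₀ * ((∫⁻ x, lineInt 0 (lineInt 2 a) x * ‖zeroExt f x‖ₑ ^ 2) +
          ∫⁻ x, lineInt 0 (lineInt 2 a) x * ‖zeroExt f₀ x‖ₑ ^ 2)) := by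
        have hmf : Measurable fun x => lineInt 0 (lineInt 2 a) x * ‖zeroExt f x‖ₑ ^ 2 :=
          hPP.mul (hm f)
        rw [lintegral_mul_lineInt 0 hP (hm2 f f₀), ← lintegral_add_left hmf]
        simp only [mul_add]
    _ ≤ C₂ * (C₀ * (C₁ * ((‖f‖ₑ ^ 2 + ‖f₂‖ₑ ^ 2) * (‖f‖ₑ ^ 2 + ‖f₁‖ₑ ^ 2)) +
          C₁ * ((‖f‖ₑ ^ 2 + ‖f₂‖ₑ ^ 2) * (‖f₀‖ₑ ^ 2 + ‖f₀₁‖ₑ ^ 2)))) :=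
        mul_le_mul_right (mul_le_mul_right (add_le_add (hlast f f₁ hf1) (hlast f₀ f₀₁ hf01)) _) _
    _ = _ := by ring

/-- Applied to `f = ∂_i u`, the second derivative of `f` is a third derivative of `u`; this is where
order three is used. -/
theorem exists_eLpNorm_grad_le {b d ξ : ℝ} (hb : 0 < b) (hd : 0 < d) (hξ : 0 < ξ) :
    ∃ C : ℝ, 0 ≤ C ∧ ∀ (u : Sob (box b d ξ) 3) (i : Fin 3),
      eLpNorm (grad u i) 4 (volume.restrict (box b d ξ : Set Space)) ≤
        ENNReal.ofReal (C * ‖u‖) := by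
  obtain ⟨C, hC, h⟩ := exists_lintegral_pow_four_le hb hd hξ
  -- Bounding every norm by `‖u‖` gives the factors `2 ‖u‖²` and `4 ‖u‖²`, whence `8`.
  refine ⟨((C * 8) ^ (1 / 4 : ℝ)).toReal, ENNReal.toReal_nonneg, fun u i => ?_⟩
  have hmem : ∀ α : Fin 3 → ℕ, ∑ k, α k ≤ 3 → α ∈ multiIdx 3 := fun α hα => mem_multiIdx.2 hα
  have hw : ∀ j : Fin 3, IsWeakDeriv (box b d ξ) (Pi.single j 1) (grad u i)
      (wderiv (Pi.single i 1 + Pi.single j 1) u) := fun j =>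
    isWeakDeriv_wderiv_single j (hmem _ (by simp [Finset.sum_add_distrib])) u
  have hw01 : IsWeakDeriv (box b d ξ) (Pi.single 1 1) (wderiv (Pi.single i 1 + Pi.single 0 1) u)
      (wderiv (Pi.single i 1 + Pi.single 0 1 + Pi.single 1 1) u) :=
    isWeakDeriv_wderiv_single 1 (hmem _ (by simp [Finset.sum_add_distrib])) u
  have hle : ∀ α, ‖wderiv α u‖ₑ ≤ ‖u‖ₑ := fun α => by
    rw [← ofReal_norm, ← ofReal_norm]
    exact ENNReal.ofReal_le_ofReal (norm_wderiv_le α u)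
  have h4 := h _ _ _ _ _ (hw 0) (hw 1) (hw 2) hw01
  rw [lintegral_enorm_zeroExt_pow _ four_ne_zero] at h4
  have h5 : eLpNorm (grad u i) 4 (volume.restrict (box b d ξ : Set Space)) ^ 4 ≤
      (C * 8) * ‖u‖ₑ ^ 4 := by
    refine h4.trans ?_
    calc _ ≤ C * ((‖u‖ₑ ^ 2 + ‖u‖ₑ ^ 2) * (‖u‖ₑ ^ 2 + ‖u‖ₑ ^ 2 + (‖u‖ₑ ^ 2 + ‖u‖ₑ ^ 2))) := by
          gcongr <;> exact hle _
      _ = _ := by ring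
  have hroot : ∀ c : ℝ≥0∞, (c ^ (1 / 4 : ℝ)) ^ 4 = c := by
    intro c
    rw [← ENNReal.rpow_natCast, ← ENNReal.rpow_mul]
    norm_num
  have hfin : (C * 8) ^ (1 / 4 : ℝ) ≠ ⊤ := by finiteness
  rw [ENNReal.ofReal_mul ENNReal.toReal_nonneg, ENNReal.ofReal_toReal hfin, ofReal_norm]
  refine (ENNReal.pow_le_pow_left_iff four_ne_zero).1 ?_
  rw [mul_pow, hroot]
  exact h5

/-! ### Differential operators as bounded operators -/

/-- The weak derivative as a bounded operator `H^m(Ω) → L²(Ω)`. -/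
def wderivL {Ω : TopologicalSpace.Opens Space} {m : ℕ} (α : Fin 3 → ℕ) : Sob Ω m →L[ℝ] L2 Ω :=
  LinearMap.mkContinuous
    { toFun := wderiv α
      map_add' := wderiv_add α
      map_smul' := wderiv_smul α } 1 (fun u => by
        rw [one_mul]
        exact norm_wderiv_le α u)

theorem wderivL_apply {Ω : TopologicalSpace.Opens Space} {m : ℕ} (α : Fin 3 → ℕ) (u : Sob Ω m) :
    wderivL α u = wderiv α u := rfl

/-- The Laplacian as a bounded operator `H^m(Ω) → L²(Ω)`. -/
def lapL {Ω : TopologicalSpace.Opens Space} {m : ℕ} : Sob Ω m →L[ℝ] L2 Ω :=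
  ∑ i : Fin 3, wderivL (Pi.single i 2)

theorem coeFn_lapL {Ω : TopologicalSpace.Opens Space} {m : ℕ} (u : Sob Ω m) :
    lapL u =ᵐ[volume.restrict (Ω : Set Space)] lap u := by
  have h1 : lapL u = ∑ i : Fin 3, wderiv (Pi.single i 2) u := by
    simp [lapL, wderivL_apply]
  rw [h1]
  filter_upwards [Lp.coeFn_finsetSum Finset.univ fun i : Fin 3 => wderiv (Pi.single i 2) u] with x hx
  rw [hx, Finset.sum_apply]
  rfl

theorem grad_sub {Ω : TopologicalSpace.Opens Space} {m : ℕ} (u v : Sob Ω m) (i : Fin 3) :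
    grad (u - v) i =ᵐ[volume.restrict (Ω : Set Space)] fun x => grad u i x - grad v i x := by
  have h1 : grad (u - v) i = grad u i - grad v i := map_sub (wderivL (Pi.single i 1)) u v
  rw [h1]
  exact Lp.coeFn_sub _ _

theorem grad_add {Ω : TopologicalSpace.Opens Space} {m : ℕ} (u v : Sob Ω m) (i : Fin 3) :
    grad (u + v) i =ᵐ[volume.restrict (Ω : Set Space)] fun x => grad u i x + grad v i x := by
  have h1 : grad (u + v) i = grad u i + grad v i := map_add (wderivL (Pi.single i 1)) u v
  rw [h1]
  exact Lp.coeFn_add _ _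

theorem grad_smul {Ω : TopologicalSpace.Opens Space} {m : ℕ} (c : ℝ) (u : Sob Ω m) (i : Fin 3) :
    grad (c • u) i =ᵐ[volume.restrict (Ω : Set Space)] fun x => c * grad u i x := by
  have h1 : grad (c • u) i = c • grad u i := map_smul (wderivL (Pi.single i 1)) c u
  rw [h1]
  filter_upwards [Lp.coeFn_smul c (grad u i)] with x hx
  rw [hx, Pi.smul_apply, Complex.real_smul]

instance fact_one_le_four : Fact ((1 : ℝ≥0∞) ≤ 4) := ⟨by norm_num⟩

instance holderTriple_four_four_two : ENNReal.HolderTriple 4 4 2 := by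
  refine ⟨?_⟩
  rw [← two_mul, show (4 : ℝ≥0∞) = 2 * 2 by norm_num, ENNReal.mul_inv (by simp) (by simp),
    ← mul_assoc, ENNReal.mul_inv_cancel (by simp) (by simp), one_mul]

theorem exists_gradL4 {b d ξ : ℝ} (hb : 0 < b) (hd : 0 < d) (hξ : 0 < ξ) (i : Fin 3) :
    ∃ g : Sob (box b d ξ) 3 →L[ℝ] Lp ℂ 4 (volume.restrict (box b d ξ : Set Space)),
      ∀ u, g u =ᵐ[volume.restrict (box b d ξ : Set Space)] grad u i := by
  obtain ⟨C, hC, h⟩ := exists_eLpNorm_grad_le hb hd hξ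
  have hmem : ∀ u : Sob (box b d ξ) 3,
      MemLp (grad u i) 4 (volume.restrict (box b d ξ : Set Space)) := fun u =>
    ⟨(Lp.memLp (grad u i)).1, (h u i).trans_lt ENNReal.ofReal_lt_top⟩
  refine ⟨LinearMap.mkContinuous
    { toFun := fun u => (hmem u).toLp _
      map_add' := fun u v => ?_
      map_smul' := fun c u => ?_ } C (fun u => ?_), fun u => ?_⟩
  · rw [← MemLp.toLp_add]
    exact MemLp.toLp_congr _ _ (grad_add u v i)
  · rw [RingHom.id_apply, ← MemLp.toLp_const_smul]
    refine MemLp.toLp_congr _ _ ?_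
    filter_upwards [grad_smul c u i] with x hx
    rw [hx, Pi.smul_apply, Complex.real_smul]
  · change ‖(hmem u).toLp _‖ ≤ _
    rw [Lp.norm_toLp]
    exact ENNReal.toReal_le_of_le_ofReal (by positivity) (h u i)
  · exact (hmem u).coeFn_toLp

/-- The bilinear form `∇u · ∇v` is bounded from `H^3 × H^3` to `L²` on a box. -/
theorem exists_gradDot {b d ξ : ℝ} (hb : 0 < b) (hd : 0 < d) (hξ : 0 < ξ) :
    ∃ β : Sob (box b d ξ) 3 →L[ℝ] Sob (box b d ξ) 3 →L[ℝ] L2 (box b d ξ),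
      ∀ u v, β u v =ᵐ[volume.restrict (box b d ξ : Set Space)]
        fun x => ∑ i : Fin 3, grad u i x * grad v i x := by
  choose g hg using exists_gradL4 hb hd hξ
  -- Hölder with `1/4 + 1/4 = 1/2`, one term for each component of the gradient.
  refine ⟨∑ i : Fin 3, ((ContinuousLinearMap.mul ℝ ℂ).holderL
    (volume.restrict (box b d ξ : Set Space)) 4 4 2).bilinearComp (g i) (g i), fun u v => ?_⟩
  have h1 : ∀ i : Fin 3, (ContinuousLinearMap.mul ℝ ℂ).holder 2 (g i u) (g i v) =ᵐ[
      volume.restrict (box b d ξ : Set Space)] fun x => grad u i x * grad v i x := by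
    intro i
    filter_upwards [(ContinuousLinearMap.mul ℝ ℂ).coeFn_holder (r := 2) (g i u) (g i v), hg i u,
      hg i v] with x h1 h2 h3
    rw [h1, h2, h3]
    rfl
  simp only [sum_apply, ContinuousLinearMap.bilinearComp_apply,
    ContinuousLinearMap.holderL_apply_apply]
  filter_upwards [Lp.coeFn_finsetSum Finset.univ fun i : Fin 3 =>
    (ContinuousLinearMap.mul ℝ ℂ).holder 2 (g i u) (g i v), ae_all_iff.2 h1] with x hx h1
  rw [hx, Finset.sum_apply]
  exact Finset.sum_congr rfl fun i _ => h1 i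

/-! ### Multiplication by bounded functions and integration in the wavenumber -/

theorem exists_mulLp {α F : Type*} [MeasurableSpace α] (μ : Measure α) [NormedAddCommGroup F]
    [NormedSpace ℝ F] {w : α → ℝ} (hw : MemLp w ⊤ μ) :
    ∃ M : Lp F 2 μ →L[ℝ] Lp F 2 μ, ∀ f, M f =ᵐ[μ] fun x => w x • f x := by
  refine ⟨(ContinuousLinearMap.lsmul ℝ ℝ).holderL μ ⊤ 2 2 (hw.toLp w), fun f => ?_⟩
  filter_upwards [(ContinuousLinearMap.lsmul ℝ ℝ).coeFn_holder (r := 2) (hw.toLp w) f,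
    hw.coeFn_toLp] with x h1 h2
  rw [ContinuousLinearMap.holderL_apply_apply, h1, h2]
  rfl

/-- Hölder against the constant `1`, which is in `L²` for a finite measure. -/
theorem exists_lpTop_to_lpTwo {α F : Type*} [MeasurableSpace α] (μ : Measure α)
    [IsFiniteMeasure μ] [NormedAddCommGroup F] [NormedSpace ℝ F] :
    ∃ M : Lp F ⊤ μ →L[ℝ] Lp F 2 μ, ∀ f, M f =ᵐ[μ] f := by
  refine ⟨((ContinuousLinearMap.lsmul ℝ ℝ (E := F)).flip.holderL μ ⊤ 2 2).flip
    (Lp.const 2 μ (1 : ℝ)), fun f => ?_⟩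
  filter_upwards [(ContinuousLinearMap.lsmul ℝ ℝ (E := F)).flip.coeFn_holder (r := 2) f
    (Lp.const 2 μ (1 : ℝ)), Lp.coeFn_const 2 μ (1 : ℝ)] with x h1 h2
  rw [ContinuousLinearMap.flip_apply, ContinuousLinearMap.holderL_apply_apply, h1, h2]
  simp

theorem sq_lintegral_enorm_coeFn_le {α F : Type*} [MeasurableSpace α] (μ : Measure α)
    [NormedAddCommGroup F] (f : Lp F 2 μ) :
    (∫⁻ x, ‖f x‖ₑ ∂μ) ^ 2 ≤ μ univ * ‖f‖ₑ ^ 2 := by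
  refine (sq_lintegral_le μ (Lp.aestronglyMeasurable f).enorm).trans (mul_le_mul_right ?_ _)
  have h1 := eLpNorm_nnreal_pow_eq_lintegral (μ := μ) (f := (f : α → F)) (p := 2) (by norm_num)
  rw [Lp.enorm_def]
  simp only [NNReal.coe_ofNat, ENNReal.rpow_ofNat, ENNReal.coe_ofNat] at h1
  rw [h1]

/-- `q ↦ (k ↦ ∫_k^{k₂} q)` is bounded from `L²` to `L^∞`. -/
theorem exists_primitive {F : Type*} [NormedAddCommGroup F] [NormedSpace ℝ F]
    {k₁ k₂ : ℝ} (hk : k₁ < k₂) :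
    ∃ K : Lp F 2 (volume.restrict (Icc k₁ k₂)) →L[ℝ] Lp F ⊤ (volume.restrict (Icc k₁ k₂)),
      ∀ q, K q =ᵐ[volume.restrict (Icc k₁ k₂)] fun k => ∫ κ in k..k₂, q κ := by
  set m := volume.restrict (Icc k₁ k₂) with hm
  have hint : ∀ q : Lp F 2 m, IntegrableOn q (Icc k₁ k₂) := fun q =>
    (Lp.memLp q).integrable (by norm_num)
  have hii : ∀ (q : Lp F 2 m), ∀ k ∈ Icc k₁ k₂, IntervalIntegrable q volume k k₂ := by
    intro q k hk'
    rw [intervalIntegrable_iff, uIoc_of_le hk'.2]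
    exact (hint q).mono_set fun x hx => ⟨hk'.1.trans hx.1.le, hx.2⟩
  have hmeas : ∀ q : Lp F 2 m, AEStronglyMeasurable (fun k => ∫ κ in k..k₂, q κ) m := by
    intro q
    have h1 := intervalIntegral.continuousOn_primitive_interval_left (μ := volume) (f := q)
      (a := k₁) (b := k₂) (by rw [uIcc_of_le hk.le]; exact hint q)
    rw [uIcc_of_le hk.le] at h1
    exact h1.aestronglyMeasurable measurableSet_Icc
  -- Cauchy-Schwarz on the whole interval, uniformly in the lower limit `k`.
  have hbd : ∀ q : Lp F 2 m, ∀ k ∈ Icc k₁ k₂,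
      ‖∫ κ in k..k₂, q κ‖ ≤ (m univ).toReal ^ (1 / 2 : ℝ) * ‖q‖ := by
    intro q k hk'
    have h1 : ‖∫ κ in k..k₂, q κ‖ₑ ≤ ∫⁻ κ, ‖q κ‖ₑ ∂m := by
      rw [intervalIntegral.integral_of_le hk'.2]
      refine (enorm_integral_le_lintegral_enorm _).trans ?_
      exact lintegral_mono_set fun x hx => ⟨hk'.1.trans hx.1.le, hx.2⟩
    have h2 := (pow_le_pow_left' h1 2).trans (sq_lintegral_enorm_coeFn_le m q)
    have h3 := ENNReal.toReal_mono (by finiteness) h2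
    rw [ENNReal.toReal_mul, ENNReal.toReal_pow, ENNReal.toReal_pow, toReal_enorm,
      toReal_enorm] at h3
    refine le_of_sq_le_sq ?_ (by positivity)
    rw [mul_pow, ← Real.sqrt_eq_rpow, Real.sq_sqrt ENNReal.toReal_nonneg]
    exact h3
  have hmem : ∀ q : Lp F 2 m, MemLp (fun k => ∫ κ in k..k₂, q κ) ⊤ m := fun q =>
    memLp_top_of_bound (hmeas q) _ ((ae_restrict_iff' measurableSet_Icc).2 (.of_forall (hbd q)))
  refine ⟨LinearMap.mkContinuous
    { toFun := fun q => (hmem q).toLp _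
      map_add' := fun q r => ?_
      map_smul' := fun c q => ?_ } ((m univ).toReal ^ (1 / 2 : ℝ)) (fun q => ?_), fun q => ?_⟩
  · rw [← MemLp.toLp_add]
    refine MemLp.toLp_congr _ _ ((ae_restrict_iff' measurableSet_Icc).2 (.of_forall fun k hk' => ?_))
    rw [Pi.add_apply, ← intervalIntegral.integral_add (hii q k hk') (hii r k hk')]
    refine intervalIntegral.integral_congr_ae ?_
    have h1 := (ae_restrict_iff' measurableSet_Icc).1 (Lp.coeFn_add q r)
    filter_upwards [h1] with x hx hx'
    rw [uIoc_of_le hk'.2] at hx'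
    exact hx ⟨hk'.1.trans hx'.1.le, hx'.2⟩
  · rw [RingHom.id_apply, ← MemLp.toLp_const_smul]
    refine MemLp.toLp_congr _ _ ((ae_restrict_iff' measurableSet_Icc).2 (.of_forall fun k hk' => ?_))
    rw [Pi.smul_apply, ← intervalIntegral.integral_smul]
    refine intervalIntegral.integral_congr_ae ?_
    have h1 := (ae_restrict_iff' measurableSet_Icc).1 (Lp.coeFn_smul c q)
    filter_upwards [h1] with x hx hx'
    rw [uIoc_of_le hk'.2] at hx'
    exact hx ⟨hk'.1.trans hx'.1.le, hx'.2⟩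
  · change ‖(hmem q).toLp _‖ ≤ _
    rw [Lp.norm_toLp]
    refine ENNReal.toReal_le_of_le_ofReal (by positivity) ?_
    rw [eLpNorm_exponent_top]
    refine eLpNormEssSup_le_of_ae_bound ?_
    exact (ae_restrict_iff' measurableSet_Icc).2 (.of_forall (hbd q))
  · exact (hmem q).coeFn_toLp

/-! ### The residual as a quadratic polynomial -/

/-- On the box `z + s > s - ξ > 0`, and `t ↦ t^{-ν}` decreases, so the weight is at most its value
at `z = -ξ`. -/
theorem memLp_top_cwf {b d ξ s : ℝ} (hs : ξ < s) {ν l : ℝ} (hν : 0 < ν) (hl : 0 < l) :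
    MemLp (fun x : Space => cwf s ν l (x 2)) ⊤ (volume.restrict (box b d ξ : Set Space)) := by
  have hm : Measurable fun x : Space => cwf s ν l (x 2) := by
    unfold cwf
    fun_prop
  refine memLp_top_of_bound hm.aestronglyMeasurable (Real.exp (2 * l * (s - ξ) ^ (-ν)))
    ((ae_restrict_iff' (box b d ξ).isOpen.measurableSet).2 (.of_forall fun x hx => ?_))
  have hx2 : -ξ < x 2 := hx.2.2.1
  rw [cwf, Real.norm_eq_abs, Real.abs_exp, Real.exp_le_exp]
  refine mul_le_mul_of_nonneg_left ?_ (by positivity)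
  exact Real.rpow_le_rpow_of_nonpos (by linarith) (by linarith) (by linarith)

/-- The operator `L` for general coefficients, as a quadratic polynomial in `(V, q)`. -/
theorem exists_quadratic {E F : Type*} [NormedAddCommGroup E] [NormedSpace ℝ E]
    [NormedAddCommGroup F] [NormedSpace ℝ F] {k₁ k₂ : ℝ} (hk : k₁ < k₂)
    (S D : E →L[ℝ] F) (β : E →L[ℝ] E →L[ℝ] F) :
    ∃ (Λ : E × Lp E 2 (volume.restrict (Icc k₁ k₂)) →L[ℝ] Lp F 2 (volume.restrict (Icc k₁ k₂)))
      (B : E × Lp E 2 (volume.restrict (Icc k₁ k₂)) →L[ℝ]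
        E × Lp E 2 (volume.restrict (Icc k₁ k₂)) →L[ℝ] Lp F 2 (volume.restrict (Icc k₁ k₂))),
      ∀ z, ∀ᵐ k ∂(volume.restrict (Icc k₁ k₂)), (Λ z + B z z) k =
        S (z.2 k) + D (k • z.2 k + (z.1 - ∫ κ in k..k₂, z.2 κ)) +
          k • β (z.1 - ∫ κ in k..k₂, z.2 κ) (k • z.2 k + (z.1 - ∫ κ in k..k₂, z.2 κ)) := by
  set m := volume.restrict (Icc k₁ k₂) with hm
  have hid : MemLp (fun k : ℝ => k) ⊤ m := by
    refine memLp_top_of_bound measurable_id.aestronglyMeasurable (max |k₁| |k₂|)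
      ((ae_restrict_iff' measurableSet_Icc).2 (.of_forall fun k hk' => ?_))
    exact abs_le_max_abs_abs hk'.1 hk'.2
  obtain ⟨ME, hME⟩ := exists_mulLp (F := E) m hid
  obtain ⟨MF, hMF⟩ := exists_mulLp (F := F) m hid
  obtain ⟨K, hK⟩ := exists_primitive (F := E) hk
  obtain ⟨ι, hι⟩ := exists_lpTop_to_lpTwo (F := E) m
  -- `A` is `V - ∫_k^{k₂} q`, bounded in `k`; `W` is `kq + V - ∫_k^{k₂} q`, only square integrable
  -- in `k`. The product `β(A, W)` is then in `L²` by Hölder with exponents `∞` and `2`.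
  let A : E × Lp E 2 m →L[ℝ] Lp E ⊤ m := (Lp.constL ⊤ m ℝ).comp (.fst ℝ _ _) - K.comp (.snd ℝ _ _)
  let W : E × Lp E 2 m →L[ℝ] Lp E 2 m := ME.comp (.snd ℝ _ _) + ι.comp A
  have hA : ∀ z, A z =ᵐ[m] fun k => z.1 - ∫ κ in k..k₂, z.2 κ := by
    intro z
    filter_upwards [Lp.coeFn_sub (Lp.const ⊤ m z.1) (K z.2), Lp.coeFn_const ⊤ m z.1, hK z.2]
      with k h1 h2 h3
    change (Lp.const ⊤ m z.1 - K z.2 : Lp E ⊤ m) k = _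
    rw [h1, Pi.sub_apply, h2, h3]
    rfl
  have hW : ∀ z, W z =ᵐ[m] fun k => k • z.2 k + (z.1 - ∫ κ in k..k₂, z.2 κ) := by
    intro z
    filter_upwards [Lp.coeFn_add (ME z.2) (ι (A z)), hME z.2, hι (A z), hA z] with k h1 h2 h3 h4
    change (ME z.2 + ι (A z)) k = _
    rw [h1, Pi.add_apply, h2, h3, h4]
  refine ⟨(S.compLpL 2 m).comp (.snd ℝ _ _) + (D.compLpL 2 m).comp W,
    ((ContinuousLinearMap.compL ℝ _ _ _ MF).comp (β.holderL m ⊤ 2 2)).bilinearComp A W,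
    fun z => ?_⟩
  filter_upwards [
    Lp.coeFn_add (S.compLpL 2 m z.2 + D.compLpL 2 m (W z)) (MF (β.holder 2 (A z) (W z))),
    Lp.coeFn_add (S.compLpL 2 m z.2) (D.compLpL 2 m (W z)),
    S.coeFn_compLpL (p := 2) (μ := m) z.2, D.coeFn_compLpL (p := 2) (μ := m) (W z),
    hMF (β.holder 2 (A z) (W z)), β.coeFn_holder (r := 2) (A z) (W z), hA z, hW z]
    with k h1 h2 h3 h4 h5 h6 h7 h8
  change (S.compLpL 2 m z.2 + D.compLpL 2 m (W z) + MF (β.holder 2 (A z) (W z))) k = _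
  rw [h1, Pi.add_apply, h2, Pi.add_apply, h3, h4, h5, h6, h7, h8]

/-- The operator `L` at a fixed wavenumber, multiplied by a weight. -/
theorem weighted_opL_ae_eq {Ω : TopologicalSpace.Opens Space} {k₁ k₂ : ℝ} (V : Sob Ω 3)
    (q : HK Ω k₁ k₂ 3) (k : ℝ) {w : Space → ℝ} {M : L2 Ω →L[ℝ] L2 Ω}
    (hM : ∀ f, M f =ᵐ[volume.restrict (Ω : Set Space)] fun x => w x • f x)
    {β : Sob Ω 3 →L[ℝ] Sob Ω 3 →L[ℝ] L2 Ω}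
    (hβ : ∀ u v, β u v =ᵐ[volume.restrict (Ω : Set Space)]
      fun x => ∑ i : Fin 3, grad u i x * grad v i x) :
    (M (lapL (q k)) + M ((2 * Complex.I) • grad (k • q k + (V - ∫ κ in k..k₂, q κ)) 2) +
      k • M ((2 : ℝ) • β (V - ∫ κ in k..k₂, q κ) (k • q k + (V - ∫ κ in k..k₂, q κ))) : L2 Ω)
      =ᵐ[volume.restrict (Ω : Set Space)] fun x => (w x : ℂ) * opL V q k x := by
  set μ := volume.restrict (Ω : Set Space)
  unfold opL
  set p := q k
  set Kq := ∫ κ in k..k₂, q κ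
  set u := k • p + (V - Kq) with hu
  have hsub : ∀ i, grad (V - Kq) i =ᵐ[μ] fun x => grad V i x - grad Kq i x := fun i =>
    grad_sub _ _ i
  have hgu : ∀ i, grad u i =ᵐ[μ] fun x => k * grad p i x + (grad V i x - grad Kq i x) := by
    intro i
    filter_upwards [grad_add (k • p) (V - Kq) i, grad_smul k p i, hsub i] with x g1 g2 g3
    rw [hu, g1, g2, g3]
  filter_upwards [
    Lp.coeFn_add (M (lapL p) + M ((2 * Complex.I) • grad u 2)) (k • M ((2 : ℝ) • β (V - Kq) u)),
    Lp.coeFn_add (M (lapL p)) (M ((2 * Complex.I) • grad u 2)),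
    Lp.coeFn_smul k (M ((2 : ℝ) • β (V - Kq) u)), hM ((2 : ℝ) • β (V - Kq) u),
    Lp.coeFn_smul (2 : ℝ) (β (V - Kq) u), hβ (V - Kq) u, hM (lapL p), coeFn_lapL p,
    hM ((2 * Complex.I) • grad u 2), Lp.coeFn_smul (2 * Complex.I) (grad u 2),
    ae_all_iff.2 hsub, ae_all_iff.2 hgu] with x g1 g2 g3 g4 g5 g6 g7 g8 g9 g10 g11 g12
  rw [g1, Pi.add_apply, g2, Pi.add_apply, g3, Pi.smul_apply, g4, g5, Pi.smul_apply, g6, g7, g8,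
    g9, g10, Pi.smul_apply]
  simp only [g11, g12, Complex.real_smul, smul_eq_mul, Fin.sum_univ_three]
  push_cast
  ring

/-- The functional contains `φ_λ²`, so `L` itself carries one factor `φ_λ`. The tail `V` is a
variable next to `q`, not a coefficient, so that `Λ` and `B`, and their norms, do not depend on it.
-/
theorem exists_weightedOpL {b d ξ : ℝ} (hb : 0 < b) (hd : 0 < d) (hξ : 0 < ξ) {s : ℝ} (hs : ξ < s)
    {k₁ k₂ : ℝ} (hk : k₁ < k₂) {ν l : ℝ} (hν : 0 < ν) (hl : 0 < l) :
    ∃ (Λ : Sob (box b d ξ) 3 × HK (box b d ξ) k₁ k₂ 3 →L[ℝ]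
        Lp (L2 (box b d ξ)) 2 (volume.restrict (Icc k₁ k₂)))
      (B : Sob (box b d ξ) 3 × HK (box b d ξ) k₁ k₂ 3 →L[ℝ]
        Sob (box b d ξ) 3 × HK (box b d ξ) k₁ k₂ 3 →L[ℝ]
        Lp (L2 (box b d ξ)) 2 (volume.restrict (Icc k₁ k₂))),
      ∀ z, ∀ᵐ k ∂(volume.restrict (Icc k₁ k₂)),
        (Λ z + B z z) k =ᵐ[volume.restrict (box b d ξ : Set Space)]
          fun x => (cwf s ν l (x 2) : ℂ) * opL z.1 z.2 k x := by
  obtain ⟨β, hβ⟩ := exists_gradDot hb hd hξ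
  obtain ⟨M, hM⟩ := exists_mulLp (F := ℂ) (volume.restrict (box b d ξ : Set Space))
    (memLp_top_cwf (b := b) (d := d) hs hν hl)
  obtain ⟨Λ, B, h⟩ := exists_quadratic hk (M.comp lapL)
    (M.comp ((2 * Complex.I) • wderivL (Pi.single 2 1)))
    ((ContinuousLinearMap.compL ℝ _ _ _ M).comp ((2 : ℝ) • β))
  refine ⟨Λ, B, fun z => ?_⟩
  filter_upwards [h z] with k hz
  rw [hz]
  exact weighted_opL_ae_eq z.1 z.2 k hM hβ

/-! ### The squared norm of a quadratic polynomial -/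

section Quartic

variable {X Y : Type*} [NormedAddCommGroup X] [NormedSpace ℝ X]
  [NormedAddCommGroup Y] [InnerProductSpace ℝ Y]

/-- The derivative of `z ↦ ‖Λ z + B z z‖²`. -/
def quarticDeriv (Λ : X →L[ℝ] Y) (B : X →L[ℝ] X →L[ℝ] Y) (z : X) : X →L[ℝ] ℝ :=
  (2 : ℝ) • (innerSL ℝ (Λ z + B z z)).comp (Λ + (B z + B.flip z))

theorem hasFDerivAt_quartic (Λ : X →L[ℝ] Y) (B : X →L[ℝ] X →L[ℝ] Y) (z : X) :
    HasFDerivAt (fun z => ‖Λ z + B z z‖ ^ 2) (quarticDeriv Λ B z) z := by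
  have h1 : HasFDerivAt (fun z => B z z) (B z + B.flip z) z := by
    have := B.hasFDerivAt_of_bilinear (hasFDerivAt_id z) (hasFDerivAt_id z)
    convert! this using 1
  convert! (Λ.hasFDerivAt.add h1).norm_sq using 1
  unfold quarticDeriv
  ext v
  simp

/-- The derivative is `2⟨Φ z, Ψ z ·⟩`, where `Φ` is the polynomial and `Ψ` its derivative. Both are
bounded and Lipschitz on the ball, and the difference of the products is split as usual. -/
theorem exists_norm_quarticDeriv_sub_le (Λ : X →L[ℝ] Y) (B : X →L[ℝ] X →L[ℝ] Y) {r : ℝ}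
    (hr : 0 ≤ r) : ∃ C : ℝ, 0 ≤ C ∧ ∀ z₁ z₂ : X, ‖z₁‖ ≤ r → ‖z₂‖ ≤ r →
      ‖quarticDeriv Λ B z₁ - quarticDeriv Λ B z₂‖ ≤ C * ‖z₁ - z₂‖ := by
  -- On the ball of radius `r`, `a` bounds `‖Ψ‖` and is a Lipschitz constant of `Φ`; as `Φ 0 = 0`,
  -- also `‖Φ‖ ≤ a r`.
  set a := ‖Λ‖ + 2 * r * ‖B‖ with ha
  have ha0 : 0 ≤ a := by positivity
  refine ⟨2 * (a * a + a * r * (2 * ‖B‖)), by positivity, fun z₁ z₂ h1 h2 => ?_⟩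
  set Φ : X → Y := fun z => Λ z + B z z with hΦ
  set Ψ : X → X →L[ℝ] Y := fun z => Λ + (B z + B.flip z) with hΨ
  have hflip : ∀ z, ‖B.flip z‖ ≤ ‖B‖ * ‖z‖ := fun z => by
    simpa using B.flip.le_opNorm z
  have e1 : ‖Φ z₁ - Φ z₂‖ ≤ a * ‖z₁ - z₂‖ := by
    have : Φ z₁ - Φ z₂ = Λ (z₁ - z₂) + (B (z₁ - z₂) z₁ + B z₂ (z₁ - z₂)) := by
      simp only [hΦ, map_sub, sub_apply]
      abel
    rw [this]
    have t1 := Λ.le_opNorm (z₁ - z₂)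
    have t2 := B.le_opNorm₂ (z₁ - z₂) z₁
    have t3 := B.le_opNorm₂ z₂ (z₁ - z₂)
    have t4 : ‖B‖ * ‖z₁ - z₂‖ * ‖z₁‖ ≤ ‖B‖ * ‖z₁ - z₂‖ * r := by gcongr
    have t5 : ‖B‖ * ‖z₂‖ * ‖z₁ - z₂‖ ≤ ‖B‖ * r * ‖z₁ - z₂‖ := by gcongr
    refine (norm_add_le _ _).trans ((add_le_add_right (norm_add_le _ _) _).trans ?_)
    rw [ha]
    linarith
  have e2 : ‖Φ z₂‖ ≤ a * r := by
    have t1 := Λ.le_opNorm z₂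
    have t2 := B.le_opNorm₂ z₂ z₂
    have t3 : ‖Λ‖ * ‖z₂‖ ≤ ‖Λ‖ * r := by gcongr
    have t4 : ‖B‖ * ‖z₂‖ * ‖z₂‖ ≤ ‖B‖ * r * r := by gcongr
    have t5 : 0 ≤ ‖B‖ * r * r := by positivity
    refine (norm_add_le _ _).trans ?_
    rw [ha]
    linarith
  have e3 : ‖Ψ z₁‖ ≤ a := by
    have t1 := B.le_opNorm z₁
    have t2 := hflip z₁
    have t3 : ‖B‖ * ‖z₁‖ ≤ ‖B‖ * r := by gcongr
    refine (norm_add_le _ _).trans ((add_le_add_right (norm_add_le _ _) _).trans ?_)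
    rw [ha]
    linarith
  have e4 : ‖Ψ z₁ - Ψ z₂‖ ≤ 2 * ‖B‖ * ‖z₁ - z₂‖ := by
    have : Ψ z₁ - Ψ z₂ = B (z₁ - z₂) + B.flip (z₁ - z₂) := by
      simp only [hΨ, map_sub]
      abel
    rw [this]
    have t1 := B.le_opNorm (z₁ - z₂)
    have t2 := hflip (z₁ - z₂)
    refine (norm_add_le _ _).trans ?_
    linarith
  have e5 : quarticDeriv Λ B z₁ - quarticDeriv Λ B z₂ =
      (2 : ℝ) • ((innerSL ℝ (Φ z₁ - Φ z₂)).comp (Ψ z₁) +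
        (innerSL ℝ (Φ z₂)).comp (Ψ z₁ - Ψ z₂)) := by
    ext v
    simp only [quarticDeriv, hΦ, hΨ, sub_apply, smul_apply, add_apply,
      ContinuousLinearMap.comp_apply, innerSL_apply_apply, inner_sub_left, inner_sub_right,
      smul_eq_mul]
    ring
  rw [e5, norm_smul]
  have f1 : ‖(innerSL ℝ (Φ z₁ - Φ z₂)).comp (Ψ z₁)‖ ≤ a * ‖z₁ - z₂‖ * a := by
    refine (ContinuousLinearMap.opNorm_comp_le _ _).trans ?_
    rw [innerSL_apply_norm]
    gcongr
  have f2 : ‖(innerSL ℝ (Φ z₂)).comp (Ψ z₁ - Ψ z₂)‖ ≤ a * r * (2 * ‖B‖ * ‖z₁ - z₂‖) := by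
    refine (ContinuousLinearMap.opNorm_comp_le _ _).trans ?_
    rw [innerSL_apply_norm]
    gcongr
  calc ‖(2 : ℝ)‖ * ‖(innerSL ℝ (Φ z₁ - Φ z₂)).comp (Ψ z₁) +
        (innerSL ℝ (Φ z₂)).comp (Ψ z₁ - Ψ z₂)‖
      ≤ 2 * (a * ‖z₁ - z₂‖ * a + a * r * (2 * ‖B‖ * ‖z₁ - z₂‖)) := by
        rw [Real.norm_ofNat]
        gcongr
        exact (norm_add_le _ _).trans (add_le_add f1 f2)
    _ = _ := by ring

end Quartic

/-! ### The regularized tail is bounded -/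

theorem EqOnBdry.sub_of_eq {Ω : TopologicalSpace.Opens Space} {f g : L2 Ω} {S : Set Space}
    {ψ : Space → ℂ} (hf : EqOnBdry f S ψ) (hg : EqOnBdry g S ψ) : EqOnBdry (f - g) S 0 := by
  obtain ⟨f', hf1, hf2, hf3⟩ := hf
  obtain ⟨g', hg1, hg2, hg3⟩ := hg
  refine ⟨f' - g', hf1.sub hg1, (Lp.coeFn_sub f g).trans (hf2.sub hg2), fun x hx => ?_⟩
  simp [hf3 hx, hg3 hx]

/-- Each boundary condition comes with its own continuous representative. The two agree almost
everywhere on the open set, hence on it, hence on its closure. -/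
theorem EqOnBdry.union {Ω : TopologicalSpace.Opens Space} {f : L2 Ω} {S T U : Set Space}
    {ψ : Space → ℂ} (hS : EqOnBdry f S ψ) (hT : EqOnBdry f T ψ) (hU : U ⊆ S ∪ T)
    (hUΩ : U ⊆ closure (Ω : Set Space)) : EqOnBdry f U ψ := by
  obtain ⟨f', hf1, hf2, hf3⟩ := hS
  obtain ⟨g', hg1, hg2, hg3⟩ := hT
  have h1 : EqOn f' g' Ω := Measure.eqOn_open_of_ae_eq (hf2.symm.trans hg2) Ω.isOpen
    (hf1.mono subset_closure) (hg1.mono subset_closure)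
  have h2 : EqOn f' g' (closure Ω) := h1.of_subset_closure hf1 hg1 subset_closure subset_rfl
  refine ⟨f', hf1, hf2, fun x hx => ?_⟩
  rcases hU hx with hx' | hx'
  · exact hf3 hx'
  · rw [h2 (hUΩ hx), hg3 hx']

theorem wderiv_sub {Ω : TopologicalSpace.Opens Space} {m : ℕ} (α : Fin 3 → ℕ) (u v : Sob Ω m) :
    wderiv α (u - v) = wderiv α u - wderiv α v := map_sub (wderivL α) u v

theorem BdryData.sub_mem_sob30 {b d ξ : ℝ} {u v : Sob (box b d ξ) 3} {ψ₀ ψ₁ : Space → ℂ}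
    (hu : BdryData u ψ₀ ψ₁) (hv : BdryData v ψ₀ ψ₁) : u - v ∈ sob30 b d ξ := by
  constructor
  · rw [wderiv_sub]
    refine (hu.1.sub_of_eq hv.1).union (hu.2.2.sub_of_eq hv.2.2) ?_ frontier_subset_closure
    intro x hx
    by_cases h : x ∈ backFace b ξ
    · exact Or.inl h
    · exact Or.inr ⟨hx, h⟩
  · rw [grad, wderiv_sub]
    exact hu.2.1.sub_of_eq hv.2.1

theorem integrable_norm_sq_coeFn {α E : Type*} [MeasurableSpace α] {μ : Measure α}
    [NormedAddCommGroup E] (f : Lp E 2 μ) : Integrable (fun x => ‖f x‖ ^ 2) μ :=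
  (Lp.memLp f).integrable_norm_pow two_ne_zero

theorem integral_norm_sq_coeFn {α E : Type*} [MeasurableSpace α] {μ : Measure α}
    [NormedAddCommGroup E] [InnerProductSpace ℝ E] (f : Lp E 2 μ) :
    ∫ x, ‖f x‖ ^ 2 ∂μ = ‖f‖ ^ 2 := by
  rw [← real_inner_self_eq_norm_sq, L2.inner_def]
  simp only [real_inner_self_eq_norm_sq]

theorem tNu_pos {s d ξ ν : ℝ} (hd : 0 < d) (hξ : 0 < ξ) (hs : ξ < s) (hν : 0 < ν) :
    0 < tNu s d ξ ν :=
  sub_pos.2 (Real.rpow_lt_rpow_of_neg (by linarith) (by linarith) (by linarith))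

/-- The choice of `μ` means `2 μ t_ν = -ln δ`. The weight is largest as `z → -ξ`, and after
normalization its limit there is `exp(2 μ t_ν) = 1/δ`. -/
theorem cwfNormalizer_mul_cwf_le {b d ξ s ν δ : ℝ} (hd : 0 < d) (hξ : 0 < ξ) (hs : ξ < s)
    (hν : 0 < ν) (hδ : 0 < δ) (hδ1 : δ < 1) {x : Space} (hx : x ∈ (box b d ξ : Set Space)) :
    cwfNormalizer s d ν (Real.log (δ ^ (-1 / (2 * tNu s d ξ ν)))) *
      cwf s ν (Real.log (δ ^ (-1 / (2 * tNu s d ξ ν)))) (x 2) ≤ δ⁻¹ := by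
  have ht := tNu_pos hd hξ hs hν
  set μ := Real.log (δ ^ (-1 / (2 * tNu s d ξ ν))) with hμ
  have hlog : Real.log δ < 0 := Real.log_neg hδ hδ1
  have hμt : 2 * μ * tNu s d ξ ν = -Real.log δ := by
    rw [hμ, Real.log_rpow hδ]
    field_simp
  have hμ0 : 0 ≤ μ := by
    by_contra hn
    nlinarith
  have hx2 : -ξ < x 2 := hx.2.2.1
  have hz : (x 2 + s) ^ (-ν) ≤ (s - ξ) ^ (-ν) :=
    Real.rpow_le_rpow_of_nonpos (by linarith) (by linarith) (by linarith)
  rw [cwfNormalizer, cwf, ← Real.exp_add, ← Real.exp_log (inv_pos.2 hδ), Real.log_inv,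
    Real.exp_le_exp, ← hμt, tNu]
  nlinarith [mul_le_mul_of_nonneg_left hz hμ0]

/-- The minimal value lies between `δ ‖V‖²` and the value at a competitor, which is of order `δ`;
dividing by `δ` leaves a bound free of `δ`. -/
theorem norm_sq_regularizedTail_le {b d ξ s ν δ : ℝ} (hd : 0 < d) (hξ : 0 < ξ) (hs : ξ < s)
    (hν : 0 < ν) (hδ : 0 < δ) (hδ1 : δ < 1) {ψ₀ ψ₁ : Space → ℂ} {Q Qs Vs V : Sob (box b d ξ) 3}
    (hQs : BdryData Qs ψ₀ ψ₁) (hQ : ‖Q - Qs‖ < δ) (hVs : BdryData Vs ψ₀ ψ₁)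
    (hlap : ∀ᵐ x ∂(volume.restrict (box b d ξ : Set Space)), lap Vs x = 0)
    (hV : IsRegularizedTail s ν (Real.log (δ ^ (-1 / (2 * tNu s d ξ ν)))) δ Q V) :
    ‖V‖ ^ 2 ≤ ‖(lapL : Sob (box b d ξ) 3 →L[ℝ] L2 (box b d ξ))‖ ^ 2 + (‖Vs‖ + 1) ^ 2 := by
  obtain ⟨W, hW, rfl, hmin⟩ := hV
  set l := Real.log (δ ^ (-1 / (2 * tNu s d ξ ν))) with hl
  set μ := volume.restrict (box b d ξ : Set Space) with hμ
  -- The competitor is `V_* - Q_*`, admissible because both functions have the same boundary data.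
  have hle := hmin (hVs.sub_mem_sob30 hQs)
  simp only [mem_ofPred_eq] at hle
  have hnorm0 : 0 < cwfNormalizer s d ν l := Real.exp_pos _
  have hfirst : δ * ‖W + Q‖ ^ 2 ≤ tailFunctional s ν l δ (W + Q) := by
    rw [tailFunctional]
    refine le_add_of_nonneg_left (mul_nonneg hnorm0.le (integral_nonneg fun x => ?_))
    exact mul_nonneg (sq_nonneg _) (Real.exp_pos _).le
  -- Since `ΔV_* = 0`, only the Laplacian of the noise `Q - Q_*` remains.
  have hlapeq : lap (Vs - Qs + Q) =ᵐ[μ] lapL (Q - Qs) := by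
    have h1 : lapL (Vs - Qs + Q) = (lapL Vs + lapL (Q - Qs) : L2 (box b d ξ)) := by
      rw [← map_add]
      congr 1
      abel
    filter_upwards [coeFn_lapL (Vs - Qs + Q), coeFn_lapL Vs, hlap,
      Lp.coeFn_add (lapL Vs : L2 (box b d ξ)) (lapL (Q - Qs))] with x g1 g2 g3 g4
    rw [← g1, h1, g4, Pi.add_apply, g2, g3, zero_add]
  have hint : cwfNormalizer s d ν l *
      (∫ x in (box b d ξ : Set Space), ‖lap (Vs - Qs + Q) x‖ ^ 2 * cwf s ν l (x 2)) ≤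
      δ⁻¹ * ‖(lapL (Q - Qs) : L2 (box b d ξ))‖ ^ 2 := by
    rw [← integral_norm_sq_coeFn, ← integral_const_mul, ← integral_const_mul]
    refine integral_mono_of_nonneg (.of_forall fun x => ?_)
      ((integrable_norm_sq_coeFn _).const_mul _) ?_
    · exact mul_nonneg hnorm0.le (mul_nonneg (sq_nonneg _) (Real.exp_pos _).le)
    · filter_upwards [hlapeq, ae_restrict_mem (box b d ξ).isOpen.measurableSet] with x g1 g2
      rw [g1, mul_left_comm, mul_comm]
      exact mul_le_mul_of_nonneg_right (cwfNormalizer_mul_cwf_le hd hξ hs hν hδ hδ1 g2)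
        (sq_nonneg _)
  have hlapn : ‖(lapL (Q - Qs) : L2 (box b d ξ))‖ ^ 2 ≤
      (‖(lapL : Sob (box b d ξ) 3 →L[ℝ] L2 (box b d ξ))‖ * δ) ^ 2 := by
    refine pow_le_pow_left₀ (norm_nonneg _) ?_ 2
    exact (lapL.le_opNorm _).trans (mul_le_mul_of_nonneg_left hQ.le (norm_nonneg _))
  have hsum : ‖Vs - Qs + Q‖ ^ 2 ≤ (‖Vs‖ + 1) ^ 2 := by
    refine pow_le_pow_left₀ (norm_nonneg _) ?_ 2
    rw [sub_add_eq_add_sub, add_sub_assoc]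
    exact (norm_add_le _ _).trans (by linarith)
  have hsecond : tailFunctional s ν l δ (Vs - Qs + Q) ≤
      δ * (‖(lapL : Sob (box b d ξ) 3 →L[ℝ] L2 (box b d ξ))‖ ^ 2 + (‖Vs‖ + 1) ^ 2) := by
    rw [tailFunctional]
    have h1 := mul_le_mul_of_nonneg_left hlapn (inv_nonneg.2 hδ.le)
    have h2 := mul_le_mul_of_nonneg_left hsum hδ.le
    -- The weight costs `1/δ`, the squared noise gains `δ²`.
    have h3 : δ⁻¹ * (‖(lapL : Sob (box b d ξ) 3 →L[ℝ] L2 (box b d ξ))‖ * δ) ^ 2 =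
        δ * ‖(lapL : Sob (box b d ξ) 3 →L[ℝ] L2 (box b d ξ))‖ ^ 2 := by
      field_simp
    linarith
  exact le_of_mul_le_mul_left ((hfirst.trans hle).trans hsecond) hδ

/-! ### The functional as the squared norm of a quadratic polynomial -/

theorem residual_eq {b d ξ k₁ k₂ s ν l : ℝ} (V : Sob (box b d ξ) 3)
    (F : HK (box b d ξ) k₁ k₂ 4) (p : HK (box b d ξ) k₁ k₂ 3) (k : ℝ) (x : Space) :
    residual s ν l V F p k x =
      ‖(cwf s ν l (x 2) : ℂ) * opL V (p + inclK _ k₁ k₂ (by norm_num : 3 ≤ 4) F) k x‖ ^ 2 := by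
  have h0 : 0 ≤ cwf s ν l (x 2) := (Real.exp_pos _).le
  rw [residual, norm_mul, Complex.norm_real, Real.norm_of_nonneg h0]
  ring

theorem norm_inclK_le {Ω : TopologicalSpace.Opens Space} {k₁ k₂ : ℝ} {m n : ℕ} (h : m ≤ n)
    (f : HK Ω k₁ k₂ n) : ‖inclK Ω k₁ k₂ h f‖ ≤ ‖f‖ := by
  have h1 : ‖incl Ω h‖ ≤ 1 := LinearMap.mkContinuous_norm_le _ zero_le_one _
  exact ((incl Ω h).norm_compLp_le f).trans (mul_le_of_le_one_left (norm_nonneg _) h1)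

section Residual

variable {b d ξ k₁ k₂ s ν l : ℝ} {F : HK (box b d ξ) k₁ k₂ 4} {V : Sob (box b d ξ) 3}
  {p : HK (box b d ξ) k₁ k₂ 3} {f : Lp (L2 (box b d ξ)) 2 (volume.restrict (Icc k₁ k₂))}

theorem ae_integrableOn_residual (hf : ∀ᵐ k ∂(volume.restrict (Icc k₁ k₂)),
      f k =ᵐ[volume.restrict (box b d ξ : Set Space)] fun x => (cwf s ν l (x 2) : ℂ) *
        opL V (p + inclK _ k₁ k₂ (by norm_num : 3 ≤ 4) F) k x) :
    ∀ᵐ k ∂(volume.restrict (Icc k₁ k₂)),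
      IntegrableOn (residual s ν l V F p k) (box b d ξ : Set Space) := by
  filter_upwards [hf] with k hk
  refine (integrable_norm_sq_coeFn (f k)).congr ?_
  filter_upwards [hk] with x hx
  rw [hx, residual_eq]

theorem integral_residual_ae_eq (hf : ∀ᵐ k ∂(volume.restrict (Icc k₁ k₂)),
      f k =ᵐ[volume.restrict (box b d ξ : Set Space)] fun x => (cwf s ν l (x 2) : ℂ) *
        opL V (p + inclK _ k₁ k₂ (by norm_num : 3 ≤ 4) F) k x) :
    (fun k => ∫ x in (box b d ξ : Set Space), residual s ν l V F p k x) =ᵐ[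
      volume.restrict (Icc k₁ k₂)] fun k => ‖f k‖ ^ 2 := by
  filter_upwards [hf] with k hk
  rw [← integral_norm_sq_coeFn]
  refine integral_congr_ae ?_
  filter_upwards [hk] with x hx
  rw [hx, residual_eq]

theorem functionalJ_eq (ρ : ℝ) (hf : ∀ᵐ k ∂(volume.restrict (Icc k₁ k₂)),
      f k =ᵐ[volume.restrict (box b d ξ : Set Space)] fun x => (cwf s ν l (x 2) : ℂ) *
        opL V (p + inclK _ k₁ k₂ (by norm_num : 3 ≤ 4) F) k x) :
    functionalJ s ν l ρ V F p = cwfNormalizer s d ν l * ‖f‖ ^ 2 + ρ * ‖p‖ ^ 2 := by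
  rw [functionalJ, integral_congr_ae (integral_residual_ae_eq hf), integral_norm_sq_coeFn]

end Residual

/-! ### Derivative of the regularized functional -/

section Regularized

variable {E H Y : Type*} [NormedAddCommGroup E] [NormedSpace ℝ E] [NormedAddCommGroup H]
  [InnerProductSpace ℝ H] [NormedAddCommGroup Y] [InnerProductSpace ℝ Y]

/-- The derivative of `p ↦ c ‖Λ z + B z z‖² + ρ ‖p‖²` with `z = (v, p + f)`. -/
def regularizedDeriv (Λ : E × H →L[ℝ] Y) (B : E × H →L[ℝ] E × H →L[ℝ] Y) (c ρ : ℝ) (v : E)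
    (f p : H) : H →L[ℝ] ℝ :=
  c • (quarticDeriv Λ B (v, p + f)).comp (.inr ℝ E H) + ρ • (2 : ℝ) • innerSL ℝ p

theorem hasFDerivAt_regularized (Λ : E × H →L[ℝ] Y) (B : E × H →L[ℝ] E × H →L[ℝ] Y) (c ρ : ℝ)
    (v : E) (f p : H) :
    HasFDerivAt (fun p => c * ‖Λ (v, p + f) + B (v, p + f) (v, p + f)‖ ^ 2 + ρ * ‖p‖ ^ 2)
      (regularizedDeriv Λ B c ρ v f p) p := by
  have h1 : HasFDerivAt (fun p : H => (v, p + f)) (ContinuousLinearMap.inr ℝ E H) p :=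
    (hasFDerivAt_const v p).prodMk ((hasFDerivAt_id p).add_const f)
  have h2 := (hasFDerivAt_quartic Λ B (v, p + f)).comp p h1
  have h3 : HasFDerivAt (fun p : H => ‖p‖ ^ 2) ((2 : ℝ) • innerSL ℝ p) p := by
    convert! (hasFDerivAt_id p).norm_sq using 1
    ext w
    simp
  exact (h2.const_mul c).add (h3.const_mul ρ)

/-- The map `p ↦ (v, p + f)` preserves distances and its derivative has norm at most one, so `C`
passes to the slice; the penalty adds `2ρ`. -/
theorem norm_regularizedDeriv_sub_le {Λ : E × H →L[ℝ] Y} {B : E × H →L[ℝ] E × H →L[ℝ] Y}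
    {c ρ r C : ℝ} (hc : 0 ≤ c) (hρ : 0 ≤ ρ)
    (hC : ∀ z₁ z₂, ‖z₁‖ ≤ r → ‖z₂‖ ≤ r →
      ‖quarticDeriv Λ B z₁ - quarticDeriv Λ B z₂‖ ≤ C * ‖z₁ - z₂‖)
    {v : E} {f p₁ p₂ : H} (hv : ‖v‖ ≤ r) (h1 : ‖p₁ + f‖ ≤ r) (h2 : ‖p₂ + f‖ ≤ r) :
    ‖regularizedDeriv Λ B c ρ v f p₁ - regularizedDeriv Λ B c ρ v f p₂‖ ≤
      (c * C + 2 * ρ) * ‖p₁ - p₂‖ := by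
  have e1 : regularizedDeriv Λ B c ρ v f p₁ - regularizedDeriv Λ B c ρ v f p₂ =
      c • (quarticDeriv Λ B (v, p₁ + f) - quarticDeriv Λ B (v, p₂ + f)).comp (.inr ℝ E H) +
        ρ • (2 : ℝ) • innerSL ℝ (p₁ - p₂) := by
    ext w
    simp [regularizedDeriv]
    ring
  have e2 := hC (v, p₁ + f) (v, p₂ + f) (max_le hv h1) (max_le hv h2)
  have e3 : ‖((v, p₁ + f) : E × H) - (v, p₂ + f)‖ = ‖p₁ - p₂‖ := by
    rw [Prod.mk_sub_mk, sub_self, add_sub_add_right_eq_sub, Prod.norm_mk, norm_zero]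
    exact max_eq_right (norm_nonneg _)
  rw [e3] at e2
  have e4 : ‖(quarticDeriv Λ B (v, p₁ + f) - quarticDeriv Λ B (v, p₂ + f)).comp
      (.inr ℝ E H)‖ ≤ C * ‖p₁ - p₂‖ := by
    refine ((ContinuousLinearMap.opNorm_comp_le _ _).trans ?_).trans e2
    exact mul_le_of_le_one_right (norm_nonneg _) (ContinuousLinearMap.norm_inr_le_one ℝ E H)
  rw [e1]
  calc _ ≤ ‖c • (quarticDeriv Λ B (v, p₁ + f) - quarticDeriv Λ B (v, p₂ + f)).comp
          (.inr ℝ E H)‖ + ‖ρ • (2 : ℝ) • innerSL ℝ (p₁ - p₂)‖ := norm_add_le _ _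
    _ ≤ c * (C * ‖p₁ - p₂‖) + ρ * (2 * ‖p₁ - p₂‖) := by
        rw [norm_smul, norm_smul, norm_smul, innerSL_apply_norm, Real.norm_of_nonneg hc,
          Real.norm_of_nonneg hρ, Real.norm_ofNat]
        gcongr
    _ = _ := by ring

end Regularized

end

end Convexification


/-! ### The Lipschitz bound for the derivative of the functional -/

open Convexification in
theorem theorem4p4
    -- the domain, the parameter `s` of the weight, and the wavenumber interval `[k₁, k₂]`
    (b d ξ : ℝ) (hb : 0 < b) (hd : 0 < d) (hξ : 0 < ξ) (s : ℝ) (hs : ξ < s)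
    (k₁ k₂ : ℝ) (hk₁ : 0 < k₁) (hk : k₁ < k₂)
    -- `lam, ν, ρ`, the radius `R'`, and bounds for `‖F_*‖` in `H_4` and `‖V_*‖` in `H^3(Ω)`
    (lam ν ρ : ℝ) (hlam : 0 < lam) (hν : 0 < ν) (hρ : 0 < ρ)
    (R' : ℝ) (hR' : 0 < R') (NF NV : ℝ) :
    ∃ M : ℝ, 0 < M ∧
      ∀ δ : ℝ, 0 < δ → δ < 1 →
      -- the exact tail `V_*`, the functions `Q, Q_*`, and the regularized tail `V`
      ∀ (ψ₀ ψ₁ ψ₀s ψ₁s : Space → ℂ) (Q Qs Vs V : Sob (box b d ξ) 3),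
      BdryData Q ψ₀ ψ₁ → BdryData Qs ψ₀s ψ₁s → ‖Q - Qs‖ < δ →
      BdryData Vs ψ₀s ψ₁s →
      (∀ᵐ x ∂(volume.restrict (box b d ξ : Set Space)), lap Vs x = 0) →
      ‖Vs‖ ≤ NV →
      IsRegularizedTail s ν (Real.log (δ ^ (-1 / (2 * tNu s d ξ ν)))) δ Q V →
      -- the functions `F, F_*`
      ∀ (φ₀ φ₁ φ₀s φ₁s : ℝ → Space → ℂ) (F Fs : HK (box b d ξ) k₁ k₂ 4),
      (∀ᵐ k ∂(volume.restrict (Icc k₁ k₂)), BdryData (F k) (φ₀ k) (φ₁ k)) →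
      (∀ᵐ k ∂(volume.restrict (Icc k₁ k₂)), BdryData (Fs k) (φ₀s k) (φ₁s k)) →
      ‖F - Fs‖ < δ → ‖Fs‖ ≤ NF →
      -- the functional is given by convergent integrals on `H_3^0`
      (∀ p ∈ hk30 b d ξ k₁ k₂,
        (∀ᵐ κ ∂(volume.restrict (Icc k₁ k₂)), IntegrableOn (residual s ν lam V F p κ)
          (box b d ξ : Set Space)) ∧
        IntegrableOn (fun κ => ∫ x in (box b d ξ : Set Space), residual s ν lam V F p κ x)
          (Icc k₁ k₂)) ∧
      -- the Fréchet derivative, as an element of `H_3`, exists at the points of `H_3^0`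
      (∀ p ∈ hk30 b d ξ k₁ k₂, DifferentiableAt ℝ (functionalJ s ν lam ρ V F) p) ∧
      -- and it is Lipschitz continuous on `B(R')`
      (∀ p₁ ∈ hk30 b d ξ k₁ k₂, ∀ p₂ ∈ hk30 b d ξ k₁ k₂, ‖p₁‖ < R' → ‖p₂‖ < R' →
        ‖gradient (functionalJ s ν lam ρ V F) p₁ - gradient (functionalJ s ν lam ρ V F) p₂‖ ≤
          M * ‖p₁ - p₂‖) ∧
      -- the same for the restriction of the functional to the space `H_3^0`
      (∀ p : hk30 b d ξ k₁ k₂,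
        DifferentiableAt ℝ (fun q : hk30 b d ξ k₁ k₂ => functionalJ s ν lam ρ V F q.1) p) ∧
      (∀ p₁ p₂ : hk30 b d ξ k₁ k₂, ‖p₁‖ < R' → ‖p₂‖ < R' →
        ‖fderiv ℝ (fun q : hk30 b d ξ k₁ k₂ => functionalJ s ν lam ρ V F q.1) p₁ -
            fderiv ℝ (fun q : hk30 b d ξ k₁ k₂ => functionalJ s ν lam ρ V F q.1) p₂‖ ≤
          M * ‖p₁ - p₂‖) := by 
  obtain ⟨Λ, B, hΛB⟩ := exists_weightedOpL hb hd hξ hs hk hν hlam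
  set a := ‖(lapL : Sob (box b d ξ) 3 →L[ℝ] L2 (box b d ξ))‖ ^ 2 + (|NV| + 1) ^ 2
  have ha : 0 ≤ a := by positivity
  -- A radius for `z = (V, p + F)` in the maximum norm, fixed before `δ` and the data: `‖V‖ ≤ √a`,
  -- `‖p‖ < R'`, and `‖F‖ ≤ |NF| + 1` because `‖F - F_*‖ < δ < 1`.
  have hr : 0 ≤ √a + R' + |NF| + 1 := by positivity
  obtain ⟨C, hC0, hC⟩ := exists_norm_quarticDeriv_sub_le Λ B hr
  have hc : 0 < cwfNormalizer s d ν lam := Real.exp_pos _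
  refine ⟨cwfNormalizer s d ν lam * C + 2 * ρ, by positivity, ?_⟩
  intro δ hδ hδ1 ψ₀ ψ₁ ψ₀s ψ₁s Q Qs Vs V _ hQs hQ hVs hlap hNV hV φ₀ φ₁ φ₀s φ₁s F Fs _ _ hF hNF
  have hVn : ‖V‖ ≤ √a := by
    refine Real.le_sqrt_of_sq_le ((norm_sq_regularizedTail_le hd hξ hs hν hδ hδ1 hQs hQ hVs hlap
      hV).trans (add_le_add_right (pow_le_pow_left₀ (by positivity) ?_ 2) _))
    linarith [le_abs_self NV]
  set f := inclK (box b d ξ) k₁ k₂ (by norm_num : 3 ≤ 4) F with hf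
  have hfn : ‖f‖ ≤ |NF| + 1 := by
    have h1 : ‖F‖ ≤ ‖F - Fs‖ + ‖Fs‖ := by simpa using norm_add_le (F - Fs) Fs
    have h2 : ‖f‖ ≤ ‖F‖ := norm_inclK_le _ F
    linarith [le_abs_self NF]
  have hres := fun p : HK (box b d ξ) k₁ k₂ 3 => hΛB (V, p + f)
  have hJ : functionalJ s ν lam ρ V F = fun p => cwfNormalizer s d ν lam *
      ‖Λ (V, p + f) + B (V, p + f) (V, p + f)‖ ^ 2 + ρ * ‖p‖ ^ 2 :=
    funext fun p => functionalJ_eq ρ (hres p)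
  have hderiv : ∀ p, HasFDerivAt (functionalJ s ν lam ρ V F)
      (regularizedDeriv Λ B (cwfNormalizer s d ν lam) ρ V f p) p := by
    intro p
    rw [hJ]
    exact hasFDerivAt_regularized Λ B _ ρ V f p
  have hball : ∀ p : HK (box b d ξ) k₁ k₂ 3, ‖p‖ < R' → ‖p + f‖ ≤ √a + R' + |NF| + 1 := by
    intro p hp
    have := norm_add_le p f
    linarith [Real.sqrt_nonneg a]
  have hlip : ∀ p₁ p₂ : HK (box b d ξ) k₁ k₂ 3, ‖p₁‖ < R' → ‖p₂‖ < R' →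
      ‖regularizedDeriv Λ B (cwfNormalizer s d ν lam) ρ V f p₁ -
        regularizedDeriv Λ B (cwfNormalizer s d ν lam) ρ V f p₂‖ ≤
        (cwfNormalizer s d ν lam * C + 2 * ρ) * ‖p₁ - p₂‖ := fun p₁ p₂ h1 h2 =>
    norm_regularizedDeriv_sub_le hc.le hρ.le hC (by linarith [abs_nonneg NF]) (hball p₁ h1)
      (hball p₂ h2)
  have hderiv' : ∀ p : hk30 b d ξ k₁ k₂,
      HasFDerivAt (fun q : hk30 b d ξ k₁ k₂ => functionalJ s ν lam ρ V F q.1)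
        ((regularizedDeriv Λ B (cwfNormalizer s d ν lam) ρ V f p.1).comp
          (hk30 b d ξ k₁ k₂).subtypeL) p := fun p =>
    (hderiv p.1).comp p (hk30 b d ξ k₁ k₂).subtypeL.hasFDerivAt
  refine ⟨fun p _ => ⟨ae_integrableOn_residual (hres p), ?_⟩,
    fun p _ => (hderiv p).differentiableAt, fun p₁ _ p₂ _ h1 h2 => ?_,
    fun p => (hderiv' p).differentiableAt, fun p₁ p₂ h1 h2 => ?_⟩
  · exact (integrable_norm_sq_coeFn _).congr (integral_residual_ae_eq (hres p)).symm
  · rw [gradient, gradient, ← map_sub, LinearIsometryEquiv.norm_map, (hderiv p₁).fderiv,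
      (hderiv p₂).fderiv]
    exact hlip p₁ p₂ h1 h2
  · rw [(hderiv' p₁).fderiv, (hderiv' p₂).fderiv, ← ContinuousLinearMap.sub_comp]
    refine (ContinuousLinearMap.opNorm_comp_le _ _).trans ?_
    refine (mul_le_of_le_one_right (norm_nonneg _) (Submodule.norm_subtypeL_le _)).trans ?_
    exact hlip p₁.1 p₂.1 h1 h2
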